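/- Let $\nu\ge 1$ and $N>\nu$. Let $\mathcal W$ be the space of non-degenerate twisted polygons: pairs $(V,M)$ of a sequence $V:\mathbb Z\to\mathbb R^\nu$ of row vectors and $M\in GL(\nu,\mathbb R)$ such that $V_{m+N}=V_mM$ and $w_m=|V_mV_{m+1}\cdots V_{m+\nu-1}|\neq0$ for all $m$. Let $P$ be the flip, $(\xi\otimes\eta)P=\eta\otimes\xi$, let $C=P-\frac1\nu\,\mathrm{Id}\otimes\mathrm{Id}$ be the Casimir element of $sl_\nu\otimes sl_\nu$, let $R\in\wedge^2 sl(\nu,\mathbb R)$ satisfy $[R^{12},R^{13}]+[R^{12},R^{23}]+[R^{13},R^{23}]=-[C^{12},C^{13}]$, let $\sigma$ be the sign function on $\mathbb Z$ ($\sigma_0=0$) and let $\varphi:\mathbb Z/N\to\mathbb R$ be odd. In the coordinates $V_0,\dots,V_{N-1},M$ on $\mathcal W$ consider the brackets $$\{V_m^1,V_n^2\}=V_m\otimes V_n\,[R+\sigma_{m-n}P+\varphi_{m-n}]\quad(0\le m,n<N),$$ $$\{V_m^1,M^2\}=V_m^1[M^2(R-C)-(R+C)M^2],$$ $$\{M^1,M^2\}=(M\otimes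 M)R+R(M\otimes M)-M^1(R+C)M^2-M^2(R-C)M^1 .$$ Let $\mathcal S_\nu$ be the space of shift operators $L=D^\nu-a^{(\nu-1)}D^{\nu-1}+\dots+(-1)^{\nu-1}a^{(1)}D+(-1)^\nu a^{(0)}$ with $N$-periodic real coefficient sequences and $a^{(0)}_m\ne0$ for all $m$, where $(Df)_m=f_{m+1}$. Each $(V,M)\in\mathcal W$ has a unique such $L$ with $LV=0$; this defines the map $\mathcal W\to\mathcal S_\nu$. For $j\ge1$, an odd $\varphi:\mathbb Z/N\to\mathbb R$ is said to be the kernel of $\frac{1+D^j}{1-D^j}$ if the operator $(\varphi f)_m=\sum_{n\in\mathbb Z/N}\varphi_{m-n}f_n$ satisfies $\varphi\,(1-D^j)g=(1+D^j)g$ for every $N$-periodic sequence $g$ in the range of $1-D^j$. Then: (0) The map $\mathcal W\to\mathcal S_\nu$ is onto, and for every odd $\varphi$ the bracket on $\mathcal W$ induces a bracket on $\mathcal S_\nu$, i.e. there is a bracket on $\mathcal S_\nu$ for which this map preserves brackets of smooth functions. For every $j\ge 1$ the operator $\frac{1+D^j}{1-D^j}$ has an odd kernel $\varphi$, which is unique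 if $j$ and $N$ are coprime. (i) If $\nu$ and $N$ are coprime and $\varphi=\varphi^{(0)}$ is the kernel of $\frac{1+D^\nu}{1-D^\nu}$, then every $a^{(0)}_m$ is a Casimir of the induced bracket on $\mathcal S_\nu$. (ii) If $0<k<\nu$ and $\varphi=\varphi^{(k)}$ is an odd kernel of $\frac{1+D^{\nu-k}}{1-D^{\nu-k}}$, then the induced Poisson tensor in the coordinates $a^{(0)},\dots,a^{(\nu-1)}$ depends linearly on $a^{(k)}$: each bracket $\{a^{(p)}_m,a^{(q)}_n\}$ is an affine function of the vector $(a^{(k)}_0,\dots,a^{(k)}_{N-1})$ when the other coefficients are fixed. -/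

import Mathlib

open scoped Kronecker ContDiff

noncomputable section

namespace Polygons

/-! ### The space of twisted polygons -/

/-- Coordinates of a twisted polygon of length `N` in `ℝ^ν`: the vertices `V_0, …, V_{N-1}`
(row vectors) and the entries of the monodromy `M`. The pair `(V, M)` with `V_{k+N} = V_k M`
for all integers `k` is determined by them. -/
abbrev Config (N ν : ℕ) : Type := (Fin N → Fin ν → ℝ) × (Fin ν → Fin ν → ℝ)

/-- The monodromy matrix. -/
def monodromy {N ν : ℕ} (x : Config N ν) : Matrix (Fin ν) (Fin ν) ℝ := Matrix.of x.2

/-- The residue of an integer modulo `N`, in `{0, …, N-1}`. -/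
def residue (N : ℕ) [NeZero N] (m : ℤ) : Fin N :=
  ⟨(m % (N : ℤ)).toNat, by
    have h : (0 : ℤ) < N := by exact_mod_cast Nat.pos_of_ne_zero (NeZero.ne N)
    have h1 := Int.emod_nonneg m h.ne'
    have h2 := Int.emod_lt_of_pos m h
    omega⟩

/-- The vertex `V_m` for an arbitrary integer `m`: `V_{r + qN} = V_r M^q` for `0 ≤ r < N`. -/
def vertex {N ν : ℕ} [NeZero N] (x : Config N ν) (m : ℤ) : Fin ν → ℝ :=
  Matrix.vecMul (x.1 (residue N m)) (monodromy x ^ (m / (N : ℤ)))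

/-- The square matrix with rows `V_m, V_{m+1}, …, V_{m+ν-1}`. -/
def window {N ν : ℕ} [NeZero N] (x : Config N ν) (m : ℤ) : Matrix (Fin ν) (Fin ν) ℝ :=
  Matrix.of fun i : Fin ν => vertex x (m + (i : ℤ))

/-- The Wronskian `w_m = |V_m V_{m+1} … V_{m+ν-1}|`. -/
def wronskian {N ν : ℕ} [NeZero N] (x : Config N ν) (m : ℤ) : ℝ := (window x m).det

/-- The space of non-degenerate twisted polygons, an open set in the coordinates:
`M` is invertible and no Wronskian vanishes (so that no vertex vanishes either). -/
def nondegenerate (N ν : ℕ) [NeZero N] : Set (Config N ν) :=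
  {x | IsUnit (monodromy x).det ∧ ∀ m : ℤ, wronskian x m ≠ 0}

/-! ### Tensors in `g ⊗ g`, `g = sl(ν, ℝ)`

An element `∑ X ⊗ Y` of `gl_ν ⊗ gl_ν` is the Kronecker product matrix, with rows and columns
indexed by pairs. -/

/-- Matrices acting on `ℝ^ν ⊗ ℝ^ν`. -/
abbrev Tensor2 (ν : ℕ) : Type := Matrix (Fin ν × Fin ν) (Fin ν × Fin ν) ℝ

/-- Matrices acting on `ℝ^ν ⊗ ℝ^ν ⊗ ℝ^ν`. -/
abbrev Tensor3 (ν : ℕ) : Type :=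
  Matrix (Fin ν × Fin ν × Fin ν) (Fin ν × Fin ν × Fin ν) ℝ

/-- The flip: `(ξ ⊗ η) P = η ⊗ ξ`. -/
def flipTensor (ν : ℕ) : Tensor2 ν :=
  Matrix.of fun p q => if p.1 = q.2 ∧ p.2 = q.1 then 1 else 0

/-- The Casimir element `C` of `sl_ν ⊗ sl_ν`, normalised by `C + (1/ν) Id ⊗ Id = P`. -/
def casimir (ν : ℕ) : Tensor2 ν := flipTensor ν - (1 / (ν : ℝ)) • (1 : Tensor2 ν)

/-- `X^{12}`. -/
def leg12 {ν : ℕ} (X : Tensor2 ν) : Tensor3 ν :=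
  Matrix.of fun p q => X (p.1, p.2.1) (q.1, q.2.1) * if p.2.2 = q.2.2 then 1 else 0

/-- `X^{13}`. -/
def leg13 {ν : ℕ} (X : Tensor2 ν) : Tensor3 ν :=
  Matrix.of fun p q => X (p.1, p.2.2) (q.1, q.2.2) * if p.2.1 = q.2.1 then 1 else 0

/-- `X^{23}`. -/
def leg23 {ν : ℕ} (X : Tensor2 ν) : Tensor3 ν :=
  Matrix.of fun p q => X (p.2.1, p.2.2) (q.2.1, q.2.2) * if p.1 = q.1 then 1 else 0

/-- `R ∈ ∧² sl_ν` is a classical r-matrix: it is antisymmetric, traceless in each leg, and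
`[R¹², R¹³] + [R¹², R²³] + [R¹³, R²³] = -[C¹², C¹³]`. -/
structure IsRMatrix {ν : ℕ} (R : Tensor2 ν) : Prop where
  antisymm : ∀ a b c d, R (c, a) (d, b) = -R (a, c) (b, d)
  traceless : ∀ c d, ∑ a, R (a, c) (a, d) = 0
  yangBaxter : ⁅leg12 R, leg13 R⁆ + ⁅leg12 R, leg23 R⁆ + ⁅leg13 R, leg23 R⁆
    = -⁅leg12 (casimir ν), leg13 (casimir ν)⁆

/-! ### The Poisson brackets on the space of twisted polygons -/

/-- The matrix of `ξ ⊗ η` as a row vector. -/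
def tensorVec {ν : ℕ} (ξ η : Fin ν → ℝ) : Fin ν × Fin ν → ℝ := fun p => ξ p.1 * η p.2

/-- `{V_m^1, V_n^2} = V_m ⊗ V_n [R + σ_{m-n} (C + (1/ν) Id ⊗ Id) + φ_{m-n}]`, `0 ≤ m, n < N`,
with `σ` the sign; the entry `(a, b)` is `{V_m^a, V_n^b}`. -/
def bracketVV {N ν : ℕ} (R : Tensor2 ν) (φ : ZMod N → ℝ) (x : Config N ν)
    (m n : Fin N) : Fin ν × Fin ν → ℝ :=
  Matrix.vecMul (tensorVec (x.1 m) (x.1 n))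
    (R + (((m : ℤ) - (n : ℤ)).sign : ℝ) • (casimir ν + (1 / (ν : ℝ)) • (1 : Tensor2 ν))
      + φ ((m : ZMod N) - (n : ZMod N)) • (1 : Tensor2 ν))

/-- `{V_m^1, M^2} = V_m^1 [M^2 (R - C) - (R + C) M^2]`; this is `{V_m^a, M_{cd}}`. -/
def bracketVM {N ν : ℕ} (R : Tensor2 ν) (x : Config N ν)
    (m : Fin N) (a c d : Fin ν) : ℝ :=
  ∑ e, x.1 m e *
    (((1 : Matrix (Fin ν) (Fin ν) ℝ) ⊗ₖ monodromy x) * (R - casimir ν)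
      - (R + casimir ν) * ((1 : Matrix (Fin ν) (Fin ν) ℝ) ⊗ₖ monodromy x)) (e, c) (a, d)

/-- `{M^1, M^2} = (M ⊗ M) R + R (M ⊗ M) - M^1 (R + C) M^2 - M^2 (R - C) M^1`;
the entry `(a, c), (b, d)` is `{M_{ab}, M_{cd}}`. -/
def bracketMM {N ν : ℕ} (R : Tensor2 ν) (x : Config N ν) : Tensor2 ν :=
  (monodromy x ⊗ₖ monodromy x) * R + R * (monodromy x ⊗ₖ monodromy x)
    - (monodromy x ⊗ₖ (1 : Matrix (Fin ν) (Fin ν) ℝ)) * (R + casimir ν)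
      * ((1 : Matrix (Fin ν) (Fin ν) ℝ) ⊗ₖ monodromy x)
    - ((1 : Matrix (Fin ν) (Fin ν) ℝ) ⊗ₖ monodromy x) * (R - casimir ν)
      * (monodromy x ⊗ₖ (1 : Matrix (Fin ν) (Fin ν) ℝ))

/-- The partial derivative `∂f / ∂V_m^a`. -/
def partialV {N ν : ℕ} (f : Config N ν → ℝ) (x : Config N ν) (m : Fin N) (a : Fin ν) : ℝ :=
  fderiv ℝ f x (Pi.single m (Pi.single a 1), 0)

/-- The partial derivative `∂f / ∂M_{ab}`. -/
def partialM {N ν : ℕ} (f : Config N ν → ℝ) (x : Config N ν) (a b : Fin ν) : ℝ :=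
  fderiv ℝ f x (0, Pi.single a (Pi.single b 1))

/-- The bracket `{f, g}` of two functions of `(V, M)` at `x`: the biderivation determined by
the brackets of the coordinate functions. -/
def bracketW {N ν : ℕ} (R : Tensor2 ν) (φ : ZMod N → ℝ) (f g : Config N ν → ℝ)
    (x : Config N ν) : ℝ :=
  (∑ m, ∑ a, ∑ n, ∑ b, partialV f x m a * partialV g x n b * bracketVV R φ x m n (a, b))
  + (∑ m, ∑ a, ∑ c, ∑ d,
      (partialV f x m a * partialM g x c d - partialM f x c d * partialV g x m a)
        * bracketVM R x m a c d)
  + ∑ a, ∑ b, ∑ c, ∑ d, partialM f x a b * partialM g x c d * bracketMM R x (a, c) (b, d)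

/-! ### The space of shift operators -/

/-- The coefficients `a^{(k)}_m`, `0 ≤ k < ν`, `m ∈ ℤ/N`, of a shift operator
`L = D^ν - a^{(ν-1)} D^{ν-1} + … + (-1)^ν a^{(0)}`. -/
abbrev Coeffs (N ν : ℕ) : Type := Fin ν → ZMod N → ℝ

/-- The space of shift operators of order `ν` with nowhere vanishing lowest coefficient. -/
def shiftOperators (N ν : ℕ) [NeZero ν] : Set (Coeffs N ν) := {u | ∀ m, u 0 m ≠ 0}

/-- The coefficients of the operator `L` with `L V = 0`: the vector of the numbers
`(-1)^{ν-1-k} a^{(k)}_m` is the solution `c` of `V_{m+ν} = ∑ k, c_k V_{m+k}`. -/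
def coeffs {N ν : ℕ} [NeZero N] (x : Config N ν) : Coeffs N ν := fun k m =>
  (-1) ^ (ν - 1 - (k : ℕ)) *
    Matrix.vecMul (vertex x ((m.val : ℤ) + (ν : ℤ))) (window x (m.val : ℤ))⁻¹ k

/-- The partial derivative `∂F / ∂a^{(k)}_m`. -/
def partialA {N ν : ℕ} [NeZero N] (F : Coeffs N ν → ℝ) (u : Coeffs N ν)
    (i : Fin ν × ZMod N) : ℝ :=
  fderiv ℝ F u (Pi.single i.1 (Pi.single i.2 1))

/-- A bivector on the space of shift operators, by its components
`P i j u = {a^{(i.1)}_{i.2}, a^{(j.1)}_{j.2}}(u)`. -/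
abbrev Bivector (N ν : ℕ) : Type :=
  Fin ν × ZMod N → Fin ν × ZMod N → Coeffs N ν → ℝ

/-- The bracket of functions on the space of shift operators given by a bivector. -/
def bracketS {N ν : ℕ} [NeZero N] (P : Bivector N ν) (F H : Coeffs N ν → ℝ)
    (u : Coeffs N ν) : ℝ :=
  ∑ i, ∑ j, partialA F u i * partialA H u j * P i j u

/-- `P` is the bivector on the space of shift operators induced by the bracket with parameters
`R`, `φ` on twisted polygons: `(V, M) ↦ a` preserves the brackets. -/
def IsInduced {N ν : ℕ} [NeZero N] [NeZero ν] (R : Tensor2 ν) (φ : ZMod N → ℝ)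
    (P : Bivector N ν) : Prop :=
  ∀ F H : Coeffs N ν → ℝ,
    ContDiffOn ℝ ∞ F (shiftOperators N ν) → ContDiffOn ℝ ∞ H (shiftOperators N ν) →
      ∀ x ∈ nondegenerate N ν,
        bracketW R φ (fun y => F (coeffs y)) (fun y => H (coeffs y)) x
          = bracketS P F H (coeffs x)

/-- `P` is linear (in general inhomogeneous) in the sequence `a^{(k)}`, the other coefficients
being fixed. -/
def IsLinearIn {N ν : ℕ} [NeZero ν] (P : Bivector N ν) (k : Fin ν) : Prop :=
  ∀ i j, ∀ u ∈ shiftOperators N ν, ∃ ℓ : (ZMod N → ℝ) →ₗ[ℝ] ℝ,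
    ∀ h : ZMod N → ℝ, Function.update u k (u k + h) ∈ shiftOperators N ν →
      P i j (Function.update u k (u k + h)) = P i j u + ℓ h

/-! ### Operators on periodic sequences and the choice of `φ` -/

/-- The shift `(D f)_m = f_{m+1}` on periodic sequences. -/
def shiftD (N : ℕ) : Module.End ℝ (ZMod N → ℝ) := LinearMap.funLeft ℝ ℝ (fun m => m + 1)

/-- The operator with kernel `K`: `(K f)_m = ∑ n, K_{m-n} f_n`. -/
def kernelOp {N : ℕ} [NeZero N] (K : ZMod N → ℝ) (f : ZMod N → ℝ) : ZMod N → ℝ :=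
  fun m => ∑ n, K (m - n) * f n

/-- The odd periodic function `φ` is the kernel of `(1 + D^j) / (1 - D^j)`. The operator
`1 - D^j` on periodic sequences kills the constants; it is invertible on its range, and the
quotient is the operator `(1 + D^j) (1 - D^j)⁻¹` there. -/
structure IsQuotientKernel {N : ℕ} [NeZero N] (j : ℕ) (φ : ZMod N → ℝ) : Prop where
  odd : ∀ m, φ (-m) = -φ m
  kernel : ∀ g ∈ LinearMap.range (1 - shiftD N ^ j),
    kernelOp φ ((1 - shiftD N ^ j) g) = (1 + shiftD N ^ j) g

end Polygons

end

open Polygons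

namespace Polygons

set_option linter.unusedSectionVars false

noncomputable section

/-! ### Kernels of the quotients `(1 + D^j) / (1 - D^j)` -/

section Kernels

/-! The proof computes the bracket of two recurrence coefficients in closed form and sees that only
the coefficients themselves enter it. Write `V_{m+ν} = ∑ c_k V_{m+k}`, put `c_ν = -1`, and
differentiate: `∑_{k<ν} V_{m+k} dc_k = -∑_{k≤ν} c_k dV_{m+k}` (`dVertex_recurrence`). Pairing this
relation at `m` with the one at `n` expresses the brackets `{c_k, c_l}`, weighted by `V_{m+k} ⊗
V_{n+l}`, through brackets of vertices. Since `ν < N`, only vertices with index in `[0, 2N)` occur,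
and `bracketForm_dVertex` treats these uniformly.

Every part of a vertex bracket that, up to a factor depending on one index only, is linear in the
other vertex is killed by `∑ c_k V_{m+k} = 0`. This removes `R` and the monodromy corrections `2/ν`.
The `φ` part survives, together with flipped terms weighted by differences of signs; these
differences vanish unless the flipped vertices again lie in the two windows (`sum_sign_reindex`).
Eliminating `V_{m+ν}` and `V_{n+ν}` and comparing coefficients in the two bases formed by the
windows gives `recBracket` (`bracketForm_dCoeff`). The chain rule then yields an induced bivector.
Every shift operator comes from a polygon (`fundamentalPolygon`), so any induced bivector agrees
with it on `shiftOperators`.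

The special kernels enter through difference equations obtained by testing on a delta function. For
`j = ν` coprime to `N`, the first difference of `φ` is known up to a constant, and it cancels the
few sign terms left in `{c_0, c_l}` (`recBracket_zero_left`). For `j = ν - k`, the second difference
of `φ` is exactly what annihilates the only possible quadratic term in `a^{(k)}`
(`exists_recBracket_update`). -/

lemma shiftD_pow_apply {N : ℕ} (j : ℕ) (g : ZMod N → ℝ) (m : ZMod N) :
    (shiftD N ^ j) g m = g (m + j) := by
  induction j generalizing m with
  | zero => simp
  | succ j ih =>
    rw [pow_succ', Module.End.mul_apply]
    change ((shiftD N ^ j) g) (m + 1) = _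
    rw [ih]
    push_cast
    ring_nf

variable {N : ℕ} [NeZero N]

lemma IsQuotientKernel.second_difference {j : ℕ} {φ : ZMod N → ℝ} (hφ : IsQuotientKernel j φ)
    (k : ZMod N) : 2 * φ k - φ (k - j) - φ (k + j) =
      (if k + j = 0 then 1 else 0) - (if k = j then 1 else 0) := by
  -- Test on `g = (1 - D^j) δ_0`; evaluating at `k - j` centres the second difference at `k`.
  have h := congrFun (hφ.kernel _ ⟨fun n => if n = 0 then 1 else 0, rfl⟩) (k - j)
  simp only [kernelOp, LinearMap.sub_apply, LinearMap.add_apply, Module.End.one_apply,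
    Pi.sub_apply, Pi.add_apply, shiftD_pow_apply, ← eq_neg_iff_add_eq_zero, mul_sub,
    Finset.sum_sub_distrib, add_assoc, mul_ite, mul_one, mul_zero, Finset.sum_ite_eq',
    Finset.mem_univ, if_true] at h
  have e1 : k - j + j = k := by ring
  have e2 : k - (j : ZMod N) = 0 ↔ k = j := sub_eq_zero
  have e3 : k - (j : ZMod N) = -(j + j) ↔ k = -j := by
    constructor <;> intro h
    · linear_combination h
    · linear_combination h
  have e4 : k - (j : ZMod N) = -j ↔ k = 0 := by
    constructor <;> intro h
    · linear_combination h
    · linear_combination h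
  have e5 : k - (j : ZMod N) - -(j + j) = k + j := by ring
  have e6 : k - (j : ZMod N) - -j = k := by ring
  simp only [sub_zero, e2, e3, e4, e5, e6] at h
  simp only [← eq_neg_iff_add_eq_zero]
  linarith

/-- Coprimality makes `j` a unit modulo `N`, so every residue is a multiple of `j`. -/
lemma eq_const_of_coprime {α : Type*} {j : ℕ} (hj : Nat.Coprime j N) {f : ZMod N → α}
    (hf : ∀ k, f (k + j) = f k) (k : ZMod N) : f k = f 0 := by
  have h : ∀ n : ℕ, f (n * j) = f 0 := by
    intro n
    induction n with
    | zero => simp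
    | succ n ih => rw [← ih, ← hf (n * j)]; congr 1; push_cast; ring
  have := h ((k * (j : ZMod N)⁻¹).val)
  rwa [ZMod.natCast_zmod_val, mul_assoc, mul_comm _ (j : ZMod N), ZMod.coe_mul_inv_eq_one j hj,
    mul_one] at this

/-- By the second difference equation the two sides differ by a `j`-periodic function, which is
constant here. The constant reflects that the kernel condition concerns only the range of `1 - D^j`.
-/
lemma IsQuotientKernel.first_difference {j : ℕ} (hj : Nat.Coprime j N) {φ : ZMod N → ℝ}
    (hφ : IsQuotientKernel j φ) : ∃ c : ℝ, ∀ k : ZMod N, φ k - φ (k + j) =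
      (if k = 0 then 1 else 0) + (if k + j = 0 then 1 else 0) + c := by
  refine ⟨φ 0 - φ (0 + j) - (if (0 : ZMod N) = 0 then 1 else 0)
    - (if (0 : ZMod N) + j = 0 then 1 else 0), fun k => ?_⟩
  have := eq_const_of_coprime hj (f := fun k => φ k - φ (k + j) - (if k = 0 then (1 : ℝ) else 0)
    - (if k + j = 0 then 1 else 0)) (fun k => ?_) k
  · linarith only [this]
  · have h := hφ.second_difference (k + j)
    have e : k + (j : ZMod N) - j = k := by ring
    rw [e] at h
    have e2 : k + (j : ZMod N) = j ↔ k = 0 := by simp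
    simp only [e2] at h
    linarith only [h]

lemma exists_isQuotientKernel (j : ℕ) : ∃ φ : ZMod N → ℝ, IsQuotientKernel j φ := by
  have hN : 0 < N := Nat.pos_of_ne_zero (NeZero.ne N)
  have hN' : (N : ℝ) ≠ 0 := by exact_mod_cast hN.ne'
  -- A sawtooth rising from `-1` to `1` along the multiples `t j`. The extra delta at `0` is the end
  -- term `v N = 1`, located at `N j = 0`; it makes the whole odd under `t ↦ N - t`, even when `j`
  -- and `N` are not coprime.
  let v : ℕ → ℝ := fun t => -1 + 2 * t / N
  refine ⟨fun k => (∑ t ∈ Finset.range N, v t * if k = (t : ZMod N) * (j : ZMod N) then 1 else 0)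
    + if k = 0 then 1 else 0, ?_, ?_⟩
  · intro k
    have hr : ∀ k : ZMod N, ((∑ t ∈ Finset.range N, v t *
        if k = (t : ZMod N) * (j : ZMod N) then (1 : ℝ) else 0) + if k = 0 then 1 else 0)
        = ∑ t ∈ Finset.range (N + 1), v t *
          if k = (t : ZMod N) * (j : ZMod N) then (1 : ℝ) else 0 := by
      intro k
      rw [Finset.sum_range_succ]
      have : v N = 1 := by simp only [v]; field_simp; ring
      simp [this]
    rw [hr, hr, ← Finset.sum_range_reflect, ← Finset.sum_neg_distrib]
    refine Finset.sum_congr rfl fun t ht => ?_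
    have ht : t ≤ N := by simpa [Nat.lt_succ_iff] using ht
    have e : N + 1 - 1 - t = N - t := by omega
    have ew : v (N - t) = - v t := by
      simp only [v]
      push_cast [ht]
      field_simp
      ring
    have ek : -k = ((N - t : ℕ) : ZMod N) * j ↔ k = t * j := by
      push_cast [ht]
      rw [CharP.cast_eq_zero]
      constructor <;> intro h
      · linear_combination -h
      · linear_combination -h
    rw [e, ew]
    simp only [ek]
    ring
  · have hk : ∀ (g : ZMod N → ℝ) (m : ZMod N),
        kernelOp (fun k => (∑ t ∈ Finset.range N, v t *
          if k = (t : ZMod N) * (j : ZMod N) then (1 : ℝ) else 0) + if k = 0 then 1 else 0) g m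
          = (∑ t ∈ Finset.range N, v t * g (m - (t : ZMod N) * (j : ZMod N))) + g m := by
      intro g m
      simp only [kernelOp, add_mul, Finset.sum_mul, Finset.sum_add_distrib]
      congr 1
      · rw [Finset.sum_comm]
        refine Finset.sum_congr rfl fun t _ => ?_
        rw [Finset.sum_eq_single (m - (t : ZMod N) * (j : ZMod N))]
        · simp
        · intro n _ hn
          rw [if_neg]
          · simp
          · intro h
            apply hn
            linear_combination -h
        · simp
      · simp [sub_eq_zero]
    rintro _ ⟨h, rfl⟩
    ext m
    rw [hk]
    simp only [LinearMap.sub_apply, LinearMap.add_apply, Module.End.one_apply,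
      Pi.sub_apply, Pi.add_apply, shiftD_pow_apply]
    -- The values of `h` read backwards along the orbit of `j`. The sum becomes `∑ v t (a (t+1) - a
    -- t)`, which must equal `2 a 0`.
    let f : ℕ → ℝ := fun t => h (m + j + j - t * j)
    let a : ℕ → ℝ := fun t => f (t + 1) - f t
    have hf : ∀ t : ℕ, f (t + N) = f t := by simp [f]
    have e : ∀ t : ℕ, h (m - t * j) - h (m - t * j + j)
        - (h (m - t * j + j) - h (m - t * j + j + j)) = a (t + 1) - a t := by
      intro t
      have e1 : m + j + j - ((t + 1 + 1 : ℕ) : ZMod N) * j = m - t * j := by push_cast; ring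
      have e2 : m + j + j - ((t + 1 : ℕ) : ZMod N) * j = m - t * j + j := by push_cast; ring
      have e3 : m + j + j - (t : ZMod N) * j = m - t * j + j + j := by ring
      simp only [a, f, e1, e2, e3]
    have e0 := e 0
    simp only [Nat.cast_zero, zero_mul, sub_zero, zero_add] at e0
    simp only [e]
    have a0 : h (m + j) - h (m + j + j) = a 0 := by simp [a, f]
    have a1 : h m - h (m + j) = a 1 := by
      linarith only [e0, a0]
    rw [a0, a1]
    -- Summation by parts: `v` has constant slope `2 / N`, so the remainder telescopes and vanishes
    -- at `s = N` by periodicity.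
    have abel : ∀ s : ℕ, ∑ t ∈ Finset.range s, v t * (a (t + 1) - a t)
        = v s * a s + a 0 - 2 / N * (f (s + 1) - f 1) := by
      intro s
      induction s with
      | zero => simp [v]
      | succ s ih =>
        rw [Finset.sum_range_succ, ih]
        simp only [v, a]
        push_cast
        ring
    have hvN : v N = 1 := by simp only [v]; field_simp; ring
    have haN : a N = a 0 := by
      have h0 := hf 0
      have h1 := hf 1
      simp only [zero_add, add_comm 1 N] at h0 h1
      simp only [a, h0, h1, zero_add]
    have hN1 : f (N + 1) = f 1 := by rw [add_comm, hf]
    rw [abel, hvN, haN, hN1]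
    ring

lemma isQuotientKernel_unique {j : ℕ} (hj : Nat.Coprime j N) {φ ψ : ZMod N → ℝ}
    (hφ : IsQuotientKernel j φ) (hψ : IsQuotientKernel j ψ) : φ = ψ := by
  obtain ⟨c, hc⟩ := hφ.first_difference hj
  obtain ⟨d, hd⟩ := hψ.first_difference hj
  have hN : (N : ℝ) ≠ 0 := by exact_mod_cast NeZero.ne N
  have hcd : ∀ k, (φ k - ψ k) - (φ (k + j) - ψ (k + j)) = c - d := fun k => by
    linarith [hc k, hd k]
  -- Summing over the cycle shows that the two constants agree; `φ - ψ` is then constant, and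
  -- oddness fixes its value at `0`.
  have hs : ∑ k : ZMod N, ((φ k - ψ k) - (φ (k + j) - ψ (k + j))) = 0 := by
    rw [Finset.sum_sub_distrib, sub_eq_zero]
    exact (Equiv.sum_comp (Equiv.addRight (j : ZMod N)) (fun k => φ k - ψ k)).symm
  simp only [hcd, Finset.sum_const, Finset.card_univ, ZMod.card, nsmul_eq_mul, mul_eq_zero, hN,
    false_or] at hs
  have h0 : φ 0 - ψ 0 = 0 := by
    have h1 := hφ.odd 0
    have h2 := hψ.odd 0
    rw [neg_zero] at h1 h2
    linarith
  funext k
  have := eq_const_of_coprime hj (f := fun k => φ k - ψ k)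
    (fun k => by linarith [hcd k]) k
  linarith

end Kernels

/-! ### Vertices and windows -/

section Vertices

variable {N ν : ℕ} [NeZero N]

lemma residue_add_mul (m q : ℤ) : residue N (m + N * q) = residue N m := by
  simp [residue]

lemma vertex_add_mul {x : Config N ν} (hM : IsUnit (monodromy x).det) (m q : ℤ) :
    vertex x (m + N * q) = Matrix.vecMul (vertex x m) (monodromy x ^ q) := by
  have hN : (N : ℤ) ≠ 0 := by exact_mod_cast NeZero.ne N
  rw [vertex, vertex, residue_add_mul, Int.add_mul_ediv_left _ _ hN, Matrix.zpow_add hM,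
    Matrix.vecMul_vecMul]

lemma residue_natCast {i : ℕ} (hi : i < N) : residue N (i : ℤ) = ⟨i, hi⟩ := by
  have : (i : ℤ) % N = i := Int.emod_eq_of_lt (by omega) (by omega)
  simp [residue, this]

lemma vertex_of_lt (x : Config N ν) {i : ℕ} (hi : i < N) : vertex x i = x.1 ⟨i, hi⟩ := by
  have : (i : ℤ) / N = 0 := Int.ediv_eq_zero_of_lt (by omega) (by omega)
  rw [vertex, residue_natCast hi, this, zpow_zero, Matrix.vecMul_one]

lemma vertex_add_of_lt (x : Config N ν) {i : ℕ} (hi : i < N) :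
    vertex x ((i : ℤ) + N) = Matrix.vecMul (x.1 ⟨i, hi⟩) (monodromy x) := by
  have hN : (N : ℤ) ≠ 0 := by exact_mod_cast NeZero.ne N
  have h0 : (i : ℤ) / N = 0 := Int.ediv_eq_zero_of_lt (by omega) (by omega)
  have h1 : ((i : ℤ) + N) / N = 1 := by 
    rw [Int.add_ediv_of_dvd_right (dvd_refl _), h0, Int.ediv_self hN, zero_add]
  have h2 := residue_add_mul (N := N) i 1
  rw [mul_one] at h2
  rw [vertex, h1, h2, residue_natCast hi, zpow_one]

lemma window_add_mul {x : Config N ν} (hM : IsUnit (monodromy x).det) (m q : ℤ) :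
    window x (m + N * q) = window x m * monodromy x ^ q := by
  ext i j
  have : m + N * q + (i : ℤ) = m + i + N * q := by ring
  simp only [window, Matrix.of_apply, this, vertex_add_mul hM]
  rfl

end Vertices

/-! ### Companion matrices -/

section Companion

variable {ν : ℕ} [NeZero ν]

/-- The matrix sending a window `V_m, …, V_{m+ν-1}` to `V_{m+1}, …, V_{m+ν}`, if
`V_{m+ν} = ∑ k, c_k V_{m+k}`. -/
def companion (c : Fin ν → ℝ) : Matrix (Fin ν) (Fin ν) ℝ :=
  Matrix.of fun i => if h : (i : ℕ) + 1 < ν then Pi.single ⟨i + 1, h⟩ 1 else c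

lemma companion_mulVec (c v : Fin ν → ℝ) (i : Fin ν) :
    (companion c).mulVec v i = if h : (i : ℕ) + 1 < ν then v ⟨i + 1, h⟩ else c ⬝ᵥ v := by
  simp only [Matrix.mulVec, companion, Matrix.of_apply]
  split_ifs <;> simp

lemma companion_mul_apply (c : Fin ν → ℝ) (A : Matrix (Fin ν) (Fin ν) ℝ) (i : Fin ν) :
    (companion c * A) i = if h : (i : ℕ) + 1 < ν then A ⟨i + 1, h⟩ else Matrix.vecMul c A := by
  ext j
  have := companion_mulVec c (fun k => A k j) i
  rw [Matrix.mul_apply]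
  simp only [Matrix.mulVec, dotProduct] at this
  rw [this]
  split_ifs <;> rfl

/-- The shifted rows force a kernel vector to be supported at `0`, and the last row then reads `c 0
* v 0 = 0`. This is where the condition `a^{(0)} ≠ 0` comes from. -/
lemma companion_det_ne_zero_iff (c : Fin ν → ℝ) : (companion c).det ≠ 0 ↔ c 0 ≠ 0 := by
  rw [not_iff_not, ← Matrix.exists_mulVec_eq_zero_iff]
  constructor
  · rintro ⟨v, hv, h⟩
    by_contra hc
    apply hv
    have hs : ∀ i : Fin ν, i ≠ 0 → v i = 0 := by
      intro i hi
      have hi' : (i : ℕ) ≠ 0 := fun h => hi (Fin.ext h)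
      have := congrFun h ⟨i - 1, by omega⟩
      rw [companion_mulVec, dif_pos (show (i : ℕ) - 1 + 1 < ν by omega)] at this
      refine Eq.trans (congrArg v ?_) this
      exact Fin.ext (show (i : ℕ) = i - 1 + 1 by omega)
    have hν : 0 < ν := Nat.pos_of_ne_zero (NeZero.ne ν)
    have := congrFun h ⟨ν - 1, by omega⟩
    rw [companion_mulVec, dif_neg (show ¬ (ν - 1 + 1 < ν) by omega), dotProduct,
      Finset.sum_eq_single 0 (fun i _ hi => by rw [hs i hi, mul_zero]) (by simp)] at this
    ext i
    by_cases hi : i = 0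
    · subst hi
      simpa [hc] using this
    · exact hs i hi
  · intro hc
    refine ⟨Pi.single 0 1, by simp, ?_⟩
    ext i
    rw [companion_mulVec]
    split_ifs with h
    · rw [Pi.single_eq_of_ne]
      · rfl
      · intro h0
        have := congrArg Fin.val h0
        simp at this
    · simp [hc]

end Companion

/-! ### The recurrence satisfied by the vertices -/

section Recurrence

variable {N ν : ℕ} [NeZero N]

/-- The solution of `V_{m+ν} = ∑ k, c_k V_{m+k}` expressed by the coefficients of the shift
operator. -/
def recCoeff (u : Coeffs N ν) (m : ZMod N) (k : Fin ν) : ℝ :=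
  (-1) ^ (ν - 1 - (k : ℕ)) * u k m

lemma recCoeff_coeffs (x : Config N ν) (m : ZMod N) :
    recCoeff (coeffs x) m =
      Matrix.vecMul (vertex x ((m.val : ℤ) + (ν : ℤ))) (window x (m.val : ℤ))⁻¹ := by
  ext k
  simp only [recCoeff, coeffs, ← mul_assoc]
  rw [← mul_pow]
  simp

lemma eq_of_recCoeff_eq {u v : Coeffs N ν} (h : ∀ m, recCoeff u m = recCoeff v m) : u = v := by
  ext k m
  have := congrFun (h m) k
  simp only [recCoeff] at this
  exact mul_left_cancel₀ (pow_ne_zero _ (by norm_num)) this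

lemma window_isUnit {x : Config N ν} (hx : x ∈ nondegenerate N ν) (m : ℤ) :
    IsUnit (window x m).det := isUnit_iff_ne_zero.2 (hx.2 m)

lemma recCoeff_vecMul_window_val {x : Config N ν} {m : ZMod N}
    (hx : IsUnit (window x m.val).det) :
    Matrix.vecMul (recCoeff (coeffs x) m) (window x m.val) = vertex x (m.val + ν) := by
  rw [recCoeff_coeffs, Matrix.vecMul_vecMul, Matrix.nonsing_inv_mul _ hx, Matrix.vecMul_one]

lemma recCoeff_vecMul_window {x : Config N ν} (hx : x ∈ nondegenerate N ν) (m : ℤ) :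
    Matrix.vecMul (recCoeff (coeffs x) m) (window x m) = vertex x (m + ν) := by
  have h := recCoeff_vecMul_window_val (window_isUnit hx ((m : ZMod N).val))
  -- The coefficients are defined from the window at the representative in `[0, N)`; multiplying by
  -- a power of the monodromy carries the recurrence to all `m`.
  have hm : m = ((m : ZMod N).val : ℤ) + N * (m / N) := by
    rw [ZMod.val_intCast, Int.emod_add_mul_ediv]
  conv_lhs => rw [hm]
  conv_rhs => rw [hm]
  rw [window_add_mul hx.1, ← Matrix.vecMul_vecMul]
  have e : ((m : ZMod N).val : ℤ) + N * (m / N) + ν = ((m : ZMod N).val : ℤ) + ν + N * (m / N) := by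
    ring
  rw [e, vertex_add_mul hx.1, ← h]
  congr 3
  simp

lemma companion_mul_window [NeZero ν] {x : Config N ν} (hx : x ∈ nondegenerate N ν) (m : ℤ) :
    companion (recCoeff (coeffs x) m) * window x m = window x (m + 1) := by
  ext i j
  rw [companion_mul_apply, recCoeff_vecMul_window hx]
  simp only [window, Matrix.of_apply]
  split_ifs with h
  · simp only [Matrix.of_apply]
    rw [show m + ((i + 1 : ℕ) : ℤ) = m + 1 + (i : ℤ) by push_cast; ring]
  · have : (i : ℤ) = ν - 1 := by omega
    rw [this, show m + 1 + ((ν : ℤ) - 1) = m + ν by ring]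

lemma coeffs_mem_shiftOperators [NeZero ν] {x : Config N ν} (hx : x ∈ nondegenerate N ν) :
    coeffs x ∈ shiftOperators N ν := by
  intro m h0
  have h := congrArg Matrix.det (companion_mul_window hx m.val)
  rw [Matrix.det_mul] at h
  have h1 := hx.2 (m.val + 1)
  rw [wronskian, ← h] at h1
  have := (companion_det_ne_zero_iff _).1 (left_ne_zero_of_mul h1)
  apply this
  simp [recCoeff, h0]

/-- The windows of the solution of the recurrence with initial window `1`. -/
def fundamental [NeZero ν] (u : Coeffs N ν) : ℕ → Matrix (Fin ν) (Fin ν) ℝ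
  | 0 => 1
  | n + 1 => companion (recCoeff u n) * fundamental u n

lemma fundamental_add_N [NeZero ν] (u : Coeffs N ν) (n : ℕ) :
    fundamental u (n + N) = fundamental u n * fundamental u N := by
  induction n with
  | zero => simp [fundamental]
  | succ n ih =>
    rw [show n + 1 + N = n + N + 1 by ring, fundamental, fundamental, ih, mul_assoc]
    simp

lemma fundamental_add_mul [NeZero ν] (u : Coeffs N ν) (n q : ℕ) :
    fundamental u (n + N * q) = fundamental u n * fundamental u N ^ q := by
  induction q with
  | zero => simp
  | succ q ih => rw [mul_add, mul_one, ← add_assoc, fundamental_add_N, ih, pow_succ, mul_assoc]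

lemma fundamental_det_ne_zero [NeZero ν] {u : Coeffs N ν} (hu : u ∈ shiftOperators N ν) (n : ℕ) :
    (fundamental u n).det ≠ 0 := by
  induction n with
  | zero => simp [fundamental]
  | succ n ih =>
    rw [fundamental, Matrix.det_mul]
    refine mul_ne_zero ((companion_det_ne_zero_iff _).2 ?_) ih
    exact mul_ne_zero (pow_ne_zero _ (by norm_num)) (hu _)

/-- A companion matrix moves rows up by one, so the products really are windows of the single
sequence of their first rows. -/
lemma fundamental_apply [NeZero ν] (u : Coeffs N ν) (n : ℕ) (i : Fin ν) :
    fundamental u n i = fundamental u (n + i) 0 := by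
  obtain ⟨i, hi⟩ := i
  induction i generalizing n with
  | zero => rfl
  | succ i ih =>
    have h : i < ν := by omega
    have := ih (n + 1) h
    rw [fundamental, companion_mul_apply, dif_pos hi] at this
    rw [this]
    rw [show n + 1 + i = n + (i + 1) by ring]

/-- The polygon with the first vertices the standard basis and given recurrence. -/
def fundamentalPolygon [NeZero ν] (u : Coeffs N ν) : Config N ν :=
  (fun n => fundamental u n 0, fundamental u N)

lemma monodromy_fundamentalPolygon [NeZero ν] (u : Coeffs N ν) :
    monodromy (fundamentalPolygon u) = fundamental u N := rfl

lemma vertex_fundamentalPolygon [NeZero ν] (u : Coeffs N ν) (n : ℕ) :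
    vertex (fundamentalPolygon u) n = fundamental u n 0 := by
  have hq : (n : ℤ) / N = ((n / N : ℕ) : ℤ) := by simp
  have hr : (residue N n : ℕ) = n % N := by
    simp only [residue]
    exact_mod_cast Int.toNat_natCast _
  rw [vertex, hq, zpow_natCast, monodromy_fundamentalPolygon]
  simp only [fundamentalPolygon, hr]
  conv_rhs => rw [← Nat.mod_add_div n N, fundamental_add_mul]
  rfl

lemma window_fundamentalPolygon [NeZero ν] (u : Coeffs N ν) (n : ℕ) :
    window (fundamentalPolygon u) n = fundamental u n := by
  ext i j
  rw [fundamental_apply, ← vertex_fundamentalPolygon]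
  simp [window]

lemma fundamentalPolygon_mem [NeZero ν] {u : Coeffs N ν} (hu : u ∈ shiftOperators N ν) :
    fundamentalPolygon u ∈ nondegenerate N ν := by
  have hM : IsUnit (monodromy (fundamentalPolygon u)).det :=
    isUnit_iff_ne_zero.2 (fundamental_det_ne_zero hu N)
  refine ⟨hM, fun m => ?_⟩
  have hN : (0 : ℤ) < N := by exact_mod_cast Nat.pos_of_ne_zero (NeZero.ne N)
  have h := window_add_mul hM (m % N).toNat (m / N)
  rw [Int.toNat_of_nonneg (Int.emod_nonneg m hN.ne'), Int.emod_add_mul_ediv] at h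
  rw [wronskian, h, Matrix.det_mul]
  refine mul_ne_zero ?_ (hM.det_zpow _).ne_zero
  rw [← Int.toNat_of_nonneg (Int.emod_nonneg m hN.ne'), window_fundamentalPolygon]
  exact fundamental_det_ne_zero hu _

lemma coeffs_fundamentalPolygon [NeZero ν] {u : Coeffs N ν} (hu : u ∈ shiftOperators N ν) :
    coeffs (fundamentalPolygon u) = u := by
  apply eq_of_recCoeff_eq
  intro m
  have hdet : IsUnit (fundamental u m.val).det :=
    isUnit_iff_ne_zero.2 (fundamental_det_ne_zero hu _)
  have hν : 0 < ν := Nat.pos_of_ne_zero (NeZero.ne ν)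
  have h : vertex (fundamentalPolygon u) (m.val + ν)
      = Matrix.vecMul (recCoeff u m) (fundamental u m.val) := by
    have h1 := fundamental_apply u (m.val + 1) ⟨ν - 1, by omega⟩
    rw [fundamental, companion_mul_apply, dif_neg (by simp only; omega)] at h1
    rw [ZMod.natCast_zmod_val] at h1
    rw [h1, ← vertex_fundamentalPolygon]
    congr 1
    push_cast
    omega
  rw [recCoeff_coeffs, window_fundamentalPolygon, h, Matrix.vecMul_vecMul,
    Matrix.mul_nonsing_inv _ hdet, Matrix.vecMul_one]

lemma coeffs_image [NeZero ν] : coeffs '' nondegenerate N ν = shiftOperators N ν := by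
  ext u
  constructor
  · rintro ⟨x, hx, rfl⟩
    exact coeffs_mem_shiftOperators hx
  · intro hu
    exact ⟨_, fundamentalPolygon_mem hu, coeffs_fundamentalPolygon hu⟩

end Recurrence

/-! ### Tensors -/

section Tensors

variable {ν : ℕ}

lemma tensorVec_vecMul_kronecker (ξ η : Fin ν → ℝ) (A B : Matrix (Fin ν) (Fin ν) ℝ) :
    Matrix.vecMul (tensorVec ξ η) (A ⊗ₖ B)
      = tensorVec (Matrix.vecMul ξ A) (Matrix.vecMul η B) := by
  ext ⟨a, b⟩
  simp only [Matrix.vecMul, dotProduct, tensorVec, Fintype.sum_prod_type,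
    Matrix.kroneckerMap_apply, Finset.sum_mul_sum]
  refine Finset.sum_congr rfl fun i _ => Finset.sum_congr rfl fun j _ => ?_
  ring

lemma vecMul_flipTensor (t : Fin ν × Fin ν → ℝ) :
    Matrix.vecMul t (flipTensor ν) = fun p => t (p.2, p.1) := by
  ext ⟨a, b⟩
  simp only [Matrix.vecMul, dotProduct, flipTensor, Matrix.of_apply, Fintype.sum_prod_type,
    ite_and, mul_ite, mul_one, mul_zero]
  simp

lemma tensorVec_vecMul_flipTensor (ξ η : Fin ν → ℝ) :
    Matrix.vecMul (tensorVec ξ η) (flipTensor ν) = tensorVec η ξ := by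
  rw [vecMul_flipTensor]
  ext ⟨a, b⟩
  simp only [tensorVec]
  ring

lemma mul_flipTensor_apply (X : Tensor2 ν) (p q : Fin ν × Fin ν) :
    (X * flipTensor ν) p q = X p (q.2, q.1) :=
  congrFun (vecMul_flipTensor (X p)) q

lemma flipTensor_mul_apply (X : Tensor2 ν) (p q : Fin ν × Fin ν) :
    (flipTensor ν * X) p q = X (p.2, p.1) q := by
  obtain ⟨a, b⟩ := p
  simp only [Matrix.mul_apply, flipTensor, Matrix.of_apply, Fintype.sum_prod_type,
    ite_and, ite_mul, one_mul, zero_mul]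
  rw [Finset.sum_eq_single b, Finset.sum_eq_single a]
  · simp
  · intro c _ hc; simp [Ne.symm hc]
  · simp
  · intro c _ hc
    refine Finset.sum_eq_zero fun d _ => ?_
    simp [Ne.symm hc]
  · simp

lemma flipTensor_mul_kronecker (A B : Matrix (Fin ν) (Fin ν) ℝ) :
    flipTensor ν * (A ⊗ₖ B) = (B ⊗ₖ A) * flipTensor ν := by
  ext p q
  rw [flipTensor_mul_apply, mul_flipTensor_apply]
  simp [mul_comm]

lemma casimir_add (ν : ℕ) :
    casimir ν + (1 / (ν : ℝ)) • (1 : Tensor2 ν) = flipTensor ν := by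
  simp [casimir]

lemma sum_mul_vecMul_fst (t : Fin ν × Fin ν → ℝ) (X : Tensor2 ν) (A : Matrix (Fin ν) (Fin ν) ℝ)
    (a b : Fin ν) : ∑ c, A c a * Matrix.vecMul t X (c, b) =
      Matrix.vecMul t (X * (A ⊗ₖ (1 : Matrix (Fin ν) (Fin ν) ℝ))) (a, b) := by
  rw [← Matrix.vecMul_vecMul]
  generalize Matrix.vecMul t X = s
  simp only [Matrix.vecMul, dotProduct, Fintype.sum_prod_type, Matrix.kroneckerMap_apply,
    Matrix.one_apply, mul_ite, mul_one, mul_zero, Finset.sum_ite_eq', Finset.mem_univ, if_true]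
  exact Finset.sum_congr rfl fun c _ => mul_comm _ _

lemma sum_mul_vecMul_snd (t : Fin ν × Fin ν → ℝ) (X : Tensor2 ν) (A : Matrix (Fin ν) (Fin ν) ℝ)
    (a b : Fin ν) : ∑ c, A c b * Matrix.vecMul t X (a, c) =
      Matrix.vecMul t (X * ((1 : Matrix (Fin ν) (Fin ν) ℝ) ⊗ₖ A)) (a, b) := by
  rw [← Matrix.vecMul_vecMul]
  generalize Matrix.vecMul t X = s
  simp only [Matrix.vecMul, dotProduct, Fintype.sum_prod_type, Matrix.kroneckerMap_apply,
    Matrix.one_apply]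
  rw [Finset.sum_comm]
  refine Finset.sum_congr rfl fun c _ => ?_
  simp [mul_comm]

lemma sum_sum_eq_vecMul (ξ η : Fin ν → ℝ) (X : Tensor2 ν) (p : Fin ν × Fin ν) :
    ∑ c, η c * ∑ e, ξ e * X (e, c) p = Matrix.vecMul (tensorVec ξ η) X p := by
  simp only [Matrix.vecMul, dotProduct, tensorVec, Fintype.sum_prod_type, Finset.mul_sum]
  rw [Finset.sum_comm]
  refine Finset.sum_congr rfl fun i _ => Finset.sum_congr rfl fun j _ => ?_
  ring

end Tensors

/-! ### The bracket as a bilinear form on covectors -/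

section Form

variable {N ν : ℕ} [NeZero N] (R : Tensor2 ν) (φ : ZMod N → ℝ) (x : Config N ν)

/-- The product of the evaluations of two covectors at two vectors. -/
def evalMul {E : Type*} [NormedAddCommGroup E] [NormedSpace ℝ E] (v w : E) :
    (E →L[ℝ] ℝ) →ₗ[ℝ] (E →L[ℝ] ℝ) →ₗ[ℝ] ℝ :=
  LinearMap.mk₂ ℝ (fun α β => α v * β w)
    (fun α α' β => by rw [add_apply, add_mul])
    (fun r α β => by rw [smul_apply, smul_eq_mul, smul_eq_mul, mul_assoc])
    (fun α β β' => by rw [add_apply, mul_add])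
    (fun r α β => by rw [smul_apply, smul_eq_mul, smul_eq_mul, mul_left_comm])

lemma evalMul_apply {E : Type*} [NormedAddCommGroup E] [NormedSpace ℝ E] (v w : E)
    (α β : E →L[ℝ] ℝ) : evalMul v w α β = α v * β w := rfl

/-- The coordinate vector `∂ / ∂V_m^a`. -/
abbrev vecV (m : Fin N) (a : Fin ν) : Config N ν := (Pi.single m (Pi.single a 1), 0)

/-- The coordinate vector `∂ / ∂M_{ab}`. -/
abbrev vecM (a b : Fin ν) : Config N ν := (0, Pi.single a (Pi.single b 1))

/-- The bivector on the space of twisted polygons as a bilinear form on covectors. -/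
def bracketForm : (Config N ν →L[ℝ] ℝ) →ₗ[ℝ] (Config N ν →L[ℝ] ℝ) →ₗ[ℝ] ℝ :=
  (∑ m, ∑ a, ∑ n, ∑ b, bracketVV R φ x m n (a, b) • evalMul (vecV m a) (vecV n b))
  + (∑ m, ∑ a, ∑ c, ∑ d, bracketVM R x m a c d •
    (evalMul (vecV m a) (vecM c d) - evalMul (vecM c d) (vecV m a)))
  + ∑ a, ∑ b, ∑ c, ∑ d, bracketMM R x (a, c) (b, d) • evalMul (vecM a b) (vecM c d)

lemma bracketForm_apply (α β : Config N ν →L[ℝ] ℝ) : bracketForm R φ x α β =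
    (∑ m, ∑ a, ∑ n, ∑ b, α (Pi.single m (Pi.single a 1), 0) * β (Pi.single n (Pi.single b 1), 0)
      * bracketVV R φ x m n (a, b))
    + (∑ m, ∑ a, ∑ c, ∑ d,
        (α (Pi.single m (Pi.single a 1), 0) * β (0, Pi.single c (Pi.single d 1))
          - α (0, Pi.single c (Pi.single d 1)) * β (Pi.single m (Pi.single a 1), 0))
          * bracketVM R x m a c d)
    + ∑ a, ∑ b, ∑ c, ∑ d, α (0, Pi.single a (Pi.single b 1)) * β (0, Pi.single c (Pi.single d 1))
      * bracketMM R x (a, c) (b, d) := by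
  simp only [bracketForm, LinearMap.add_apply, LinearMap.sub_apply, LinearMap.sum_apply,
    LinearMap.smul_apply, evalMul_apply, smul_eq_mul]
  refine congrArg₂ (· + ·) (congrArg₂ (· + ·) ?_ ?_) ?_ <;>
  exact Finset.sum_congr rfl fun _ _ => Finset.sum_congr rfl fun _ _ =>
    Finset.sum_congr rfl fun _ _ => Finset.sum_congr rfl fun _ _ => mul_comm _ _

/-- Brackets of functions become values of a bilinear form, so linear relations between
differentials can be inserted directly. -/
lemma bracketW_eq (f g : Config N ν → ℝ) :
    bracketW R φ f g x = bracketForm R φ x (fderiv ℝ f x) (fderiv ℝ g x) := by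
  rw [bracketForm_apply]
  rfl

/-- The differential of `V_m^a`. -/
def dV (m : Fin N) (a : Fin ν) : Config N ν →L[ℝ] ℝ :=
  (ContinuousLinearMap.proj a : (Fin ν → ℝ) →L[ℝ] ℝ).comp
    ((ContinuousLinearMap.proj m : (Fin N → Fin ν → ℝ) →L[ℝ] (Fin ν → ℝ)).comp
      (ContinuousLinearMap.fst ℝ _ _))

/-- The differential of `M_{ab}`. -/
def dM (a b : Fin ν) : Config N ν →L[ℝ] ℝ :=
  (ContinuousLinearMap.proj b : (Fin ν → ℝ) →L[ℝ] ℝ).comp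
    ((ContinuousLinearMap.proj a : (Fin ν → Fin ν → ℝ) →L[ℝ] (Fin ν → ℝ)).comp
      (ContinuousLinearMap.snd ℝ _ _))

lemma dV_apply (m : Fin N) (a : Fin ν) (y : Config N ν) : dV m a y = y.1 m a := rfl

lemma dM_apply (a b : Fin ν) (y : Config N ν) : dM a b y = y.2 a b := rfl

lemma single_single_apply {ι κ : Type*} [DecidableEq ι] [DecidableEq κ] (m m' : ι) (a a' : κ) :
    (Pi.single m' (Pi.single a' 1) : ι → κ → ℝ) m a
      = if m' = m then (if a' = a then 1 else 0) else 0 := by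
  by_cases h : m' = m
  · subst h
    simp [Pi.single_apply, eq_comm]
  · simp [h]

lemma bracketForm_dV_dV (m n : Fin N) (a b : Fin ν) :
    bracketForm R φ x (dV m a) (dV n b) = bracketVV R φ x m n (a, b) := by
  simp [bracketForm_apply, dV_apply, single_single_apply, ite_mul]

lemma bracketForm_dV_dM (m : Fin N) (a c d : Fin ν) :
    bracketForm R φ x (dV m a) (dM c d) = bracketVM R x m a c d := by
  simp [bracketForm_apply, dV_apply, dM_apply, single_single_apply, ite_mul]

lemma bracketForm_dM_dV (m : Fin N) (a c d : Fin ν) :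
    bracketForm R φ x (dM c d) (dV m a) = -bracketVM R x m a c d := by
  simp [bracketForm_apply, dV_apply, dM_apply, single_single_apply, ite_mul]

lemma bracketForm_dM_dM (a b c d : Fin ν) :
    bracketForm R φ x (dM a b) (dM c d) = bracketMM R x (a, c) (b, d) := by
  simp [bracketForm_apply, dM_apply, single_single_apply, ite_mul]

/-- The differential of the vertex `V_{m+N} = V_m M`. -/
def dVM (m : Fin N) (a : Fin ν) : Config N ν →L[ℝ] ℝ :=
  (∑ b, monodromy x b a • dV m b) + ∑ b, x.1 m b • dM b a

lemma hasFDerivAt_vertex_of_lt {i : ℕ} (hi : i < N) (a : Fin ν) :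
    HasFDerivAt (fun y : Config N ν => vertex y i a) (dV ⟨i, hi⟩ a) x := by
  have : (fun y : Config N ν => vertex y i a) = fun y => dV ⟨i, hi⟩ a y := by
    ext y
    rw [vertex_of_lt y hi, dV_apply]
  rw [this]
  exact (dV _ a).hasFDerivAt

lemma hasFDerivAt_vertex_add {i : ℕ} (hi : i < N) (a : Fin ν) :
    HasFDerivAt (fun y : Config N ν => vertex y ((i : ℤ) + N) a) (dVM x ⟨i, hi⟩ a) x := by
  have : (fun y : Config N ν => vertex y ((i : ℤ) + N) a)
      = fun y => ∑ b, dV ⟨i, hi⟩ b y * dM b a y := by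
    ext y
    rw [vertex_add_of_lt y hi]
    rfl
  rw [this]
  have h := HasFDerivAt.fun_sum (u := Finset.univ) fun (b : Fin ν) _ =>
    (dV ⟨i, hi⟩ b).hasFDerivAt (x := x) |>.mul ((dM b a).hasFDerivAt (x := x))
  refine h.congr_fderiv ?_
  rw [dVM, ← Finset.sum_add_distrib]
  refine Finset.sum_congr rfl fun b _ => ?_
  rw [add_comm]
  rfl

end Form

/-! ### Brackets among the vertices `V_m` and `V_{m+N} = V_m M` -/

section VertexBrackets

variable {N ν : ℕ} [NeZero N] {R : Tensor2 ν} (φ : ZMod N → ℝ) (x : Config N ν)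

lemma bracketForm_dM_dV_eq (hR : IsRMatrix R) (n : Fin N) (a b c : Fin ν) :
    bracketForm R φ x (dM c a) (dV n b) = ∑ e, x.1 n e *
      ((monodromy x ⊗ₖ (1 : Matrix (Fin ν) (Fin ν) ℝ)) * (R + casimir ν)
        - (R - casimir ν) * (monodromy x ⊗ₖ (1 : Matrix (Fin ν) (Fin ν) ℝ))) (c, e) (a, b) := by
  rw [bracketForm_dM_dV, bracketVM, ← Finset.sum_neg_distrib]
  refine Finset.sum_congr rfl fun e _ => ?_
  rw [← mul_neg]
  congr 1
  have hRP : flipTensor ν * R = -(R * flipTensor ν) := by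
    ext ⟨p, q⟩ ⟨r, s⟩
    rw [flipTensor_mul_apply, Matrix.neg_apply, mul_flipTensor_apply]
    exact hR.antisymm p s q r
  have hCP : flipTensor ν * casimir ν = casimir ν * flipTensor ν := by
    simp [casimir, mul_sub, sub_mul]
  have h := flipTensor_mul_kronecker (1 : Matrix (Fin ν) (Fin ν) ℝ) (monodromy x)
  -- Conjugation by `P` exchanges the tensor legs: `R` changes sign, `C` is fixed, and `M^2` becomes
  -- `M^1`.
  have key : flipTensor ν * (((1 : Matrix (Fin ν) (Fin ν) ℝ) ⊗ₖ monodromy x) * (R - casimir ν)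
      - (R + casimir ν) * ((1 : Matrix (Fin ν) (Fin ν) ℝ) ⊗ₖ monodromy x))
      = -(((monodromy x ⊗ₖ (1 : Matrix (Fin ν) (Fin ν) ℝ)) * (R + casimir ν)
        - (R - casimir ν) * (monodromy x ⊗ₖ (1 : Matrix (Fin ν) (Fin ν) ℝ))) * flipTensor ν) := by
    rw [mul_sub, ← mul_assoc, ← mul_assoc, h, mul_add, add_mul, hRP, hCP]
    rw [mul_assoc, mul_sub, hRP, hCP, sub_mul, mul_assoc, mul_assoc (R - casimir ν), ← h]
    noncomm_ring
  have := congrFun (congrFun key (c, e)) (b, a)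
  rw [flipTensor_mul_apply, Matrix.neg_apply, mul_flipTensor_apply] at this
  exact neg_eq_iff_eq_neg.2 this

lemma bracketForm_dV_dV_eq (m n : Fin N) (a b : Fin ν) :
    bracketForm R φ x (dV m a) (dV n b) =
      Matrix.vecMul (tensorVec (x.1 m) (x.1 n)) R (a, b)
      + φ ((m : ZMod N) - (n : ZMod N)) * (x.1 m a * x.1 n b)
      + (((m : ℤ) - (n : ℤ)).sign : ℝ) * (x.1 n a * x.1 m b) := by
  rw [bracketForm_dV_dV, bracketVV, casimir_add, Matrix.vecMul_add, Matrix.vecMul_add,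
    Matrix.vecMul_smul, Matrix.vecMul_smul, tensorVec_vecMul_flipTensor, Matrix.vecMul_one]
  simp only [Pi.add_apply, Pi.smul_apply, smul_eq_mul, tensorVec]
  ring

lemma bracketForm_dV_dVM (m n : Fin N) (a b : Fin ν) :
    bracketForm R φ x (dV m a) (dVM x n b) =
      Matrix.vecMul (tensorVec (x.1 m) (Matrix.vecMul (x.1 n) (monodromy x))) R (a, b)
      + (φ ((m : ZMod N) - (n : ZMod N)) + 2 / ν)
        * (x.1 m a * Matrix.vecMul (x.1 n) (monodromy x) b)
      - Matrix.vecMul (x.1 n) (monodromy x) a * x.1 m b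
      + ((((m : ℤ) - (n : ℤ)).sign : ℝ) - 1)
        * (x.1 n a * Matrix.vecMul (x.1 m) (monodromy x) b) := by
  simp only [dVM, map_add, map_sum, map_smul, smul_eq_mul, bracketForm_dV_dV, bracketForm_dV_dM,
    bracketVV, bracketVM]
  rw [sum_mul_vecMul_snd, sum_sum_eq_vecMul, ← Pi.add_apply, ← Matrix.vecMul_add]
  set S : ℝ := (((m : ℤ) - (n : ℤ)).sign : ℝ)
  set f : ℝ := φ ((m : ZMod N) - (n : ZMod N))
  -- The `R` terms move past `M^2`. Of the two copies of `-C = -P + 1/ν`, one gives the term with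
  -- `M^2 P`, the other shifts `S` to `S - 1`, and their scalar parts add up to `2 / ν`.
  have key : (R + S • (casimir ν + (1 / (ν : ℝ)) • (1 : Tensor2 ν)) + f • (1 : Tensor2 ν))
        * ((1 : Matrix (Fin ν) (Fin ν) ℝ) ⊗ₖ monodromy x)
      + (((1 : Matrix (Fin ν) (Fin ν) ℝ) ⊗ₖ monodromy x) * (R - casimir ν)
        - (R + casimir ν) * ((1 : Matrix (Fin ν) (Fin ν) ℝ) ⊗ₖ monodromy x))
      = ((1 : Matrix (Fin ν) (Fin ν) ℝ) ⊗ₖ monodromy x) * R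
        + (f + 2 / ν) • ((1 : Matrix (Fin ν) (Fin ν) ℝ) ⊗ₖ monodromy x)
        - ((1 : Matrix (Fin ν) (Fin ν) ℝ) ⊗ₖ monodromy x) * flipTensor ν
        + (S - 1) • (flipTensor ν * ((1 : Matrix (Fin ν) (Fin ν) ℝ) ⊗ₖ monodromy x)) := by
    rw [casimir_add, casimir]
    simp only [add_mul, sub_mul, mul_sub, smul_mul_assoc, mul_smul_comm, one_mul, mul_one]
    module
  rw [key]
  simp only [Matrix.vecMul_add, Matrix.vecMul_sub, Matrix.vecMul_smul, ← Matrix.vecMul_vecMul,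
    tensorVec_vecMul_kronecker, tensorVec_vecMul_flipTensor, Matrix.vecMul_one, Pi.add_apply,
    Pi.sub_apply, Pi.smul_apply, smul_eq_mul]
  simp only [tensorVec]

lemma bracketForm_dVM_dV (hR : IsRMatrix R) (m n : Fin N) (a b : Fin ν) :
    bracketForm R φ x (dVM x m a) (dV n b) =
      Matrix.vecMul (tensorVec (Matrix.vecMul (x.1 m) (monodromy x)) (x.1 n)) R (a, b)
      + (φ ((m : ZMod N) - (n : ZMod N)) - 2 / ν)
        * (Matrix.vecMul (x.1 m) (monodromy x) a * x.1 n b)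
      + x.1 n a * Matrix.vecMul (x.1 m) (monodromy x) b
      + ((((m : ℤ) - (n : ℤ)).sign : ℝ) + 1)
        * (Matrix.vecMul (x.1 n) (monodromy x) a * x.1 m b) := by
  simp only [dVM, map_add, map_sum, map_smul, smul_eq_mul, bracketForm_dV_dV,
    bracketForm_dM_dV_eq φ x hR, bracketVV, LinearMap.add_apply, LinearMap.sum_apply,
    LinearMap.smul_apply]
  have hsw : ∀ X : Tensor2 ν, ∑ c, x.1 m c * ∑ e, x.1 n e * X (c, e) (a, b)
      = Matrix.vecMul (tensorVec (x.1 m) (x.1 n)) X (a, b) := by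
    intro X
    rw [← sum_sum_eq_vecMul]
    simp only [Finset.mul_sum]
    rw [Finset.sum_comm]
    refine Finset.sum_congr rfl fun i _ => Finset.sum_congr rfl fun j _ => ?_
    ring
  rw [sum_mul_vecMul_fst, hsw, ← Pi.add_apply, ← Matrix.vecMul_add]
  set S : ℝ := (((m : ℤ) - (n : ℤ)).sign : ℝ)
  set f : ℝ := φ ((m : ZMod N) - (n : ZMod N))
  have key : (R + S • (casimir ν + (1 / (ν : ℝ)) • (1 : Tensor2 ν)) + f • (1 : Tensor2 ν))
        * (monodromy x ⊗ₖ (1 : Matrix (Fin ν) (Fin ν) ℝ))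
      + ((monodromy x ⊗ₖ (1 : Matrix (Fin ν) (Fin ν) ℝ)) * (R + casimir ν)
        - (R - casimir ν) * (monodromy x ⊗ₖ (1 : Matrix (Fin ν) (Fin ν) ℝ)))
      = (monodromy x ⊗ₖ (1 : Matrix (Fin ν) (Fin ν) ℝ)) * R
        + (f - 2 / ν) • (monodromy x ⊗ₖ (1 : Matrix (Fin ν) (Fin ν) ℝ))
        + (monodromy x ⊗ₖ (1 : Matrix (Fin ν) (Fin ν) ℝ)) * flipTensor ν
        + (S + 1) • (flipTensor ν * (monodromy x ⊗ₖ (1 : Matrix (Fin ν) (Fin ν) ℝ))) := by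
    rw [casimir_add, casimir]
    simp only [add_mul, mul_add, sub_mul, mul_sub, smul_mul_assoc, mul_smul_comm, one_mul, mul_one]
    module
  rw [key]
  simp only [Matrix.vecMul_add, Matrix.vecMul_smul, ← Matrix.vecMul_vecMul,
    tensorVec_vecMul_kronecker, tensorVec_vecMul_flipTensor, Matrix.vecMul_one, Pi.add_apply,
    Pi.smul_apply, smul_eq_mul]
  simp only [tensorVec]

/-- The formula is that for two vertices of the first period, with both translated: `{M, M}` is
designed so that all Casimir terms cancel. -/
lemma bracketForm_dVM_dVM (hR : IsRMatrix R) (m n : Fin N) (a b : Fin ν) :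
    bracketForm R φ x (dVM x m a) (dVM x n b) =
      Matrix.vecMul (tensorVec (Matrix.vecMul (x.1 m) (monodromy x))
        (Matrix.vecMul (x.1 n) (monodromy x))) R (a, b)
      + φ ((m : ZMod N) - (n : ZMod N))
        * (Matrix.vecMul (x.1 m) (monodromy x) a * Matrix.vecMul (x.1 n) (monodromy x) b)
      + (((m : ℤ) - (n : ℤ)).sign : ℝ)
        * (Matrix.vecMul (x.1 n) (monodromy x) a * Matrix.vecMul (x.1 m) (monodromy x) b) := by
  set S : ℝ := (((m : ℤ) - (n : ℤ)).sign : ℝ) with hS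
  set f : ℝ := φ ((m : ZMod N) - (n : ZMod N)) with hf
  set M₁ : Tensor2 ν := monodromy x ⊗ₖ (1 : Matrix (Fin ν) (Fin ν) ℝ) with hM₁
  set M₂ : Tensor2 ν := (1 : Matrix (Fin ν) (Fin ν) ℝ) ⊗ₖ monodromy x with hM₂
  have hsw : ∀ X : Tensor2 ν, ∀ p, ∑ c, x.1 m c * ∑ e, x.1 n e * X (c, e) p
      = Matrix.vecMul (tensorVec (x.1 m) (x.1 n)) X p := by
    intro X p
    rw [← sum_sum_eq_vecMul]
    simp only [Finset.mul_sum]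
    rw [Finset.sum_comm]
    refine Finset.sum_congr rfl fun i _ => Finset.sum_congr rfl fun j _ => ?_
    ring
  have h1 : ∀ c, bracketForm R φ x (dV m c) (dVM x n b)
      = Matrix.vecMul (tensorVec (x.1 m) (x.1 n)) ((R + S • flipTensor ν + f • (1 : Tensor2 ν)) * M₂
        + (M₂ * (R - casimir ν) - (R + casimir ν) * M₂)) (c, b) := by
    intro c
    simp only [dVM, map_add, map_sum, map_smul, smul_eq_mul, bracketForm_dV_dV, bracketForm_dV_dM,
      bracketVV, bracketVM]
    rw [sum_mul_vecMul_snd, sum_sum_eq_vecMul, ← Pi.add_apply, ← Matrix.vecMul_add, casimir_add]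
  have h2 : ∑ c, x.1 m c * bracketForm R φ x (dM c a) (dVM x n b)
      = Matrix.vecMul (tensorVec (x.1 m) (x.1 n)) ((M₁ * (R + casimir ν) - (R - casimir ν) * M₁) * M₂
        + bracketMM R x) (a, b) := by
    simp only [dVM, map_add, map_sum, map_smul, smul_eq_mul, bracketForm_dM_dV_eq φ x hR,
      bracketForm_dM_dM, mul_add, Finset.sum_add_distrib]
    rw [Matrix.vecMul_add, Pi.add_apply, hsw, ← sum_mul_vecMul_snd]
    congr 1
    simp only [Finset.mul_sum, ← hsw]
    rw [Finset.sum_comm]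
    refine Finset.sum_congr rfl fun i _ => Finset.sum_congr rfl fun j _ =>
      Finset.sum_congr rfl fun k _ => ?_
    ring
  have h3 : bracketForm R φ x (dVM x m a) (dVM x n b)
      = ∑ c, monodromy x c a * bracketForm R φ x (dV m c) (dVM x n b)
        + ∑ c, x.1 m c * bracketForm R φ x (dM c a) (dVM x n b) := by
    conv_lhs => rw [dVM]
    simp only [map_add, map_sum, map_smul, smul_eq_mul, LinearMap.add_apply, LinearMap.sum_apply,
      LinearMap.smul_apply]
  rw [h3, h2]
  simp only [h1]
  rw [sum_mul_vecMul_fst, ← Pi.add_apply, ← Matrix.vecMul_add, ← hM₁]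
  have hM : monodromy x ⊗ₖ monodromy x = M₁ * M₂ := by
    rw [hM₁, hM₂, ← Matrix.mul_kronecker_mul, mul_one, one_mul]
  have hcomm : M₂ * M₁ = M₁ * M₂ := by
    rw [hM₁, hM₂, ← Matrix.mul_kronecker_mul, ← Matrix.mul_kronecker_mul]
    simp
  have hP : flipTensor ν * (M₁ * M₂) = M₁ * M₂ * flipTensor ν := by
    rw [← hM, flipTensor_mul_kronecker]
  have key : ((R + S • flipTensor ν + f • (1 : Tensor2 ν)) * M₂
        + (M₂ * (R - casimir ν) - (R + casimir ν) * M₂)) * M₁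
      + ((M₁ * (R + casimir ν) - (R - casimir ν) * M₁) * M₂ + bracketMM R x)
      = M₁ * M₂ * R + f • (M₁ * M₂) + S • (M₁ * M₂ * flipTensor ν) := by
    rw [bracketMM, hM, ← hM₁, ← hM₂, ← hP, casimir]
    simp only [add_mul, mul_add, sub_mul, mul_sub, smul_mul_assoc, mul_smul_comm, one_mul, mul_one,
      mul_assoc, hcomm]
    module
  rw [key, ← hM]
  simp only [Matrix.vecMul_add, Matrix.vecMul_smul, ← Matrix.vecMul_vecMul,
    tensorVec_vecMul_kronecker, tensorVec_vecMul_flipTensor, Pi.add_apply,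
    Pi.smul_apply, smul_eq_mul]
  simp only [tensorVec]

end VertexBrackets

/-! ### Brackets of arbitrary vertices -/

section AllVertices

variable {N ν : ℕ} [NeZero N] {R : Tensor2 ν} (φ : ZMod N → ℝ) {x : Config N ν}

/-- The differential of `V_z^a`. -/
def dVertex (x : Config N ν) (z : ℤ) (a : Fin ν) : Config N ν →L[ℝ] ℝ :=
  fderiv ℝ (fun y => vertex y z a) x

/-- The contribution of a translate by `j` periods to the bracket of `V_i^a` and `V_p^b`. -/
def translateTerm (x : Config N ν) (i p : ℤ) (a b : Fin ν) (j : ℤ) : ℝ :=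
  (((i - p + j * N).sign : ℝ) - (j.sign : ℝ)) * (vertex x (p - j * N) a * vertex x (i + j * N) b)

/-- One formula for the four cases according to the periods of `i` and `p`. As `|i - p| < 2N`, a
translate with `|j| ≥ 2` would have `i - p + jN` of the same sign as `j`, so three values of `j`
suffice. -/
lemma bracketForm_dVertex (hR : IsRMatrix R) {i p : ℤ}
    (hi : 0 ≤ i) (hi' : i < 2 * N) (hp : 0 ≤ p) (hp' : p < 2 * N) (a b : Fin ν) :
    bracketForm R φ x (dVertex x i a) (dVertex x p b) =
      Matrix.vecMul (tensorVec (vertex x i) (vertex x p)) R (a, b)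
      + (φ (i - p) + 2 / ν * ((p / N : ℤ) - (i / N : ℤ))) * (vertex x i a * vertex x p b)
      + ∑ j ∈ ({-1, 0, 1} : Finset ℤ), translateTerm x i p a b j := by
  have hN : (N : ℤ) ≠ 0 := by exact_mod_cast NeZero.ne N
  have hsum : ∀ f : ℤ → ℝ, ∑ j ∈ ({-1, 0, 1} : Finset ℤ), f j = f (-1) + f 0 + f 1 := by
    intro f
    rw [Finset.sum_insert (by decide), Finset.sum_insert (by decide), Finset.sum_singleton]
    ring
  have hcases : ∀ z : ℤ, 0 ≤ z → z < 2 * N → ∃ r : ℕ, ∃ h : r < N, z = r ∨ z = r + N := by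
    intro z h0 h1
    by_cases h : z < N
    · exact ⟨z.toNat, by omega, Or.inl (by omega)⟩
    · exact ⟨(z - N).toNat, by omega, Or.inr (by omega)⟩
  have hq0 : ∀ r : ℕ, r < N → (r : ℤ) / N = 0 := fun r h =>
    Int.ediv_eq_zero_of_lt (by omega) (by omega)
  have hq1 : ∀ r : ℕ, r < N → ((r : ℤ) + N) / N = 1 := fun r h => by
    rw [Int.add_ediv_of_dvd_right (dvd_refl _), hq0 r h, Int.ediv_self hN, zero_add]
  have d0 : ∀ r : ℕ, ∀ h : r < N, ∀ a, dVertex x r a = dV ⟨r, h⟩ a := fun r h a =>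
    (hasFDerivAt_vertex_of_lt x h a).fderiv
  have d1 : ∀ r : ℕ, ∀ h : r < N, ∀ a, dVertex x ((r : ℤ) + N) a = dVM x ⟨r, h⟩ a := fun r h a =>
    (hasFDerivAt_vertex_add x h a).fderiv
  obtain ⟨r, hr, hir⟩ := hcases i hi hi'
  obtain ⟨s, hs, hps⟩ := hcases p hp hp'
  simp only [hsum, translateTerm]
  rcases hir with rfl | rfl <;> rcases hps with rfl | rfl
  · rw [d0 r hr, d0 s hs, bracketForm_dV_dV_eq, hq0 r hr, hq0 s hs]
    have s1 : ((r : ℤ) - s + (-1) * N).sign = -1 := Int.sign_eq_neg_one_of_neg (by omega)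
    have s2 : ((r : ℤ) - s + 1 * N).sign = 1 := Int.sign_eq_one_of_pos (by omega)
    rw [s1, s2]
    simp only [zero_mul, add_zero, sub_zero, vertex_of_lt x hr, vertex_of_lt x hs]
    simp
  · rw [d0 r hr, d1 s hs, bracketForm_dV_dVM, hq0 r hr, hq1 s hs]
    have s1 : ((r : ℤ) - (s + N) + (-1) * N).sign = -1 := Int.sign_eq_neg_one_of_neg (by omega)
    have s2 : ((r : ℤ) - (s + N) + 0 * N).sign = -1 := Int.sign_eq_neg_one_of_neg (by omega)
    have e1 : (r : ℤ) - (s + N) + 1 * N = r - s := by ring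
    have e2 : (s : ℤ) + N - 1 * N = s := by ring
    rw [s1, s2, e1, e2, one_mul]
    simp only [zero_mul, add_zero, sub_zero, vertex_of_lt x hr, vertex_of_lt x hs,
      vertex_add_of_lt x hr, vertex_add_of_lt x hs]
    simp
    ring
  · rw [d1 r hr, d0 s hs, bracketForm_dVM_dV φ x hR, hq1 r hr, hq0 s hs]
    have s1 : ((r : ℤ) + N - s + 1 * N).sign = 1 := Int.sign_eq_one_of_pos (by omega)
    have s2 : ((r : ℤ) + N - s + 0 * N).sign = 1 := Int.sign_eq_one_of_pos (by omega)
    have e1 : (r : ℤ) + N - s + (-1) * N = r - s := by ring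
    have e2 : (s : ℤ) - (-1) * N = s + N := by ring
    have e3 : (r : ℤ) + N + (-1) * N = r := by ring
    rw [s1, s2, e1, e2, e3]
    simp only [zero_mul, add_zero, sub_zero, vertex_of_lt x hr, vertex_of_lt x hs,
      vertex_add_of_lt x hr, vertex_add_of_lt x hs]
    simp
    ring
  · rw [d1 r hr, d1 s hs, bracketForm_dVM_dVM φ x hR, hq1 r hr, hq1 s hs]
    have s1 : ((r : ℤ) + N - (s + N) + (-1) * N).sign = -1 :=
      Int.sign_eq_neg_one_of_neg (by omega)
    have s2 : ((r : ℤ) + N - (s + N) + 1 * N).sign = 1 := Int.sign_eq_one_of_pos (by omega)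
    have e1 : (r : ℤ) + N - (s + N) = r - s := by ring
    rw [s1, s2, e1]
    simp only [zero_mul, add_zero, sub_zero, vertex_add_of_lt x hr, vertex_add_of_lt x hs]
    simp

end AllVertices

/-! ### Differentiability of the coefficients -/

section Smoothness

lemma differentiableAt_det {E n : Type*} [NormedAddCommGroup E] [NormedSpace ℝ E] [Fintype n]
    [DecidableEq n] {A : E → Matrix n n ℝ} {x : E}
    (hA : ∀ i j, DifferentiableAt ℝ (fun y => A y i j) x) :
    DifferentiableAt ℝ (fun y => (A y).det) x := by
  simp only [Matrix.det_apply]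
  refine DifferentiableAt.fun_sum fun σ _ => ?_
  exact (HasFDerivAt.finsetProd fun i _ => (hA _ _).hasFDerivAt).differentiableAt.const_smul _

lemma differentiableAt_inv {E n : Type*} [NormedAddCommGroup E] [NormedSpace ℝ E] [Fintype n]
    [DecidableEq n] {A : E → Matrix n n ℝ} {x : E}
    (hA : ∀ i j, DifferentiableAt ℝ (fun y => A y i j) x) (hx : (A x).det ≠ 0) (i j : n) :
    DifferentiableAt ℝ (fun y => (A y)⁻¹ i j) x := by
  simp only [Matrix.inv_def, Matrix.smul_apply, Ring.inverse_eq_inv', smul_eq_mul,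
    Matrix.adjugate_apply]
  refine (differentiableAt_det hA).inv hx |>.mul (differentiableAt_det fun k l => ?_)
  by_cases h : k = j
  · subst h
    simp
  · simpa [Matrix.updateRow_ne h] using hA k l

variable {N ν : ℕ} [NeZero N] {x : Config N ν}

lemma differentiableAt_vertex {z : ℤ} (hz : 0 ≤ z) (hz' : z < 2 * N) (a : Fin ν) :
    DifferentiableAt ℝ (fun y : Config N ν => vertex y z a) x := by
  by_cases h : z < N
  · obtain ⟨r, rfl⟩ := Int.eq_ofNat_of_zero_le hz
    exact (hasFDerivAt_vertex_of_lt x (by omega) a).differentiableAt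
  · obtain ⟨r, hr⟩ := Int.eq_ofNat_of_zero_le (show 0 ≤ z - N by omega)
    obtain rfl : z = r + N := by omega
    exact (hasFDerivAt_vertex_add x (by omega) a).differentiableAt

lemma differentiableAt_window (hν : ν < N) (m : ZMod N) (i j : Fin ν) :
    DifferentiableAt ℝ (fun y : Config N ν => window y m.val i j) x := by
  have := ZMod.val_lt m
  exact differentiableAt_vertex (by omega) (by omega) _

lemma differentiableAt_recCoeff (hν : ν < N) (hx : x ∈ nondegenerate N ν) (m : ZMod N)
    (k : Fin ν) : DifferentiableAt ℝ (fun y : Config N ν => recCoeff (coeffs y) m k) x := by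
  have := ZMod.val_lt m
  simp only [recCoeff_coeffs, Matrix.vecMul, dotProduct]
  refine DifferentiableAt.fun_sum fun l _ => ?_
  exact (differentiableAt_vertex (by omega) (by omega) _).mul
    (differentiableAt_inv (differentiableAt_window hν m) (hx.2 _) _ _)

lemma differentiableAt_coeffs (hν : ν < N) (hx : x ∈ nondegenerate N ν) :
    DifferentiableAt ℝ (coeffs : Config N ν → Coeffs N ν) x := by
  refine differentiableAt_pi.2 fun k => differentiableAt_pi.2 fun m => ?_
  have h : (fun y : Config N ν => coeffs y k m)
      = fun y => (-1) ^ (ν - 1 - (k : ℕ)) * recCoeff (coeffs y) m k := by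
    ext y
    simp only [recCoeff, ← mul_assoc]
    rw [← mul_pow]
    simp
  rw [h]
  exact (differentiableAt_recCoeff hν hx m k).const_mul _

/-- The differential of the coefficient `c_k` of the recurrence at `m`. -/
def dCoeff (x : Config N ν) (m : ZMod N) (k : Fin ν) : Config N ν →L[ℝ] ℝ :=
  fderiv ℝ (fun y => recCoeff (coeffs y) m k) x

lemma dVertex_recurrence (hν : ν < N) (hx : x ∈ nondegenerate N ν) (m : ZMod N) (a : Fin ν) :
    dVertex x (m.val + ν) a = ∑ k : Fin ν, (vertex x (m.val + (k : ℤ)) a • dCoeff x m k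
      + recCoeff (coeffs x) m k • dVertex x (m.val + (k : ℤ)) a) := by
  -- The recurrence can be differentiated only where it holds on a neighbourhood, and it needs an
  -- invertible window.
  have hdet : ∀ᶠ y in nhds x, (window y m.val).det ≠ 0 :=
    (differentiableAt_det (differentiableAt_window hν m)).continuousAt.eventually_ne (hx.2 _)
  have heq : (fun y : Config N ν => vertex y (m.val + ν) a) =ᶠ[nhds x]
      fun y => ∑ k : Fin ν, recCoeff (coeffs y) m k * vertex y (m.val + (k : ℤ)) a := by
    filter_upwards [hdet] with y hy
    rw [← recCoeff_vecMul_window_val (isUnit_iff_ne_zero.2 hy)]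
    rfl
  have hm := ZMod.val_lt m
  rw [dVertex, heq.fderiv_eq]
  have h := HasFDerivAt.fun_sum (u := Finset.univ) fun (k : Fin ν) _ =>
    (differentiableAt_recCoeff hν hx m k).hasFDerivAt.mul
      (differentiableAt_vertex (x := x) (z := m.val + (k : ℤ)) (by omega) (by omega) a).hasFDerivAt
  refine h.fderiv.trans ?_
  refine Finset.sum_congr rfl fun k _ => ?_
  rw [add_comm]
  rfl

end Smoothness

/-! ### Bilinear expressions in two recurrences -/

section Bilinear

lemma sum_Icc_eq_sum_fin (ν : ℕ) (f : ℤ → ℝ) :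
    ∑ k ∈ Finset.Icc (0 : ℤ) ν, f k = (∑ k : Fin ν, f (k : ℤ)) + f ν := by
  rw [Fin.sum_univ_eq_sum_range (fun k => f (k : ℤ)), ← Finset.sum_range_succ (fun k => f (k : ℤ))]
  symm
  refine Finset.sum_bij_ne_zero (fun k _ _ => (k : ℤ)) ?_ ?_ ?_ ?_
  · intro k hk _
    simp only [Finset.mem_range, Finset.mem_Icc] at *
    omega
  · intro _ _ _ _ _ _ h
    exact_mod_cast h
  · intro k hk _
    simp only [Finset.mem_Icc] at hk
    refine ⟨k.toNat, ?_, ?_, by omega⟩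
    · simp only [Finset.mem_range]
      omega
    · rwa [Int.toNat_of_nonneg hk.1]
  · intro _ _ _
    rfl

lemma sum_sum_mul_left_eq_zero {ι κ : Type*} {s : Finset ι} {t : Finset κ} {c : ι → ℝ}
    {F : ι → κ → ℝ} (h : ∀ l ∈ t, ∑ k ∈ s, c k * F k l = 0) (d : κ → ℝ) :
    ∑ k ∈ s, ∑ l ∈ t, c k * d l * F k l = 0 := by
  rw [Finset.sum_comm]
  refine Finset.sum_eq_zero fun l hl => ?_
  have : ∑ k ∈ s, c k * d l * F k l = d l * ∑ k ∈ s, c k * F k l := by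
    rw [Finset.mul_sum]
    exact Finset.sum_congr rfl fun k _ => by ring
  rw [this, h l hl, mul_zero]

lemma sum_sum_mul_right_eq_zero {ι κ : Type*} {s : Finset ι} {t : Finset κ} {d : κ → ℝ}
    {F : ι → κ → ℝ} (h : ∀ k ∈ s, ∑ l ∈ t, d l * F k l = 0) (c : ι → ℝ) :
    ∑ k ∈ s, ∑ l ∈ t, c k * d l * F k l = 0 := by
  refine Finset.sum_eq_zero fun k hk => ?_
  have : ∑ l ∈ t, c k * d l * F k l = c k * ∑ l ∈ t, d l * F k l := by
    rw [Finset.mul_sum]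
    exact Finset.sum_congr rfl fun l _ => by ring
  rw [this, h k hk, mul_zero]

/-- The coefficients of `V_m, …, V_{m+ν}` in a recurrence, extended by zero. -/
structure IsRecExtension (ν : ℕ) (c : ℤ → ℝ) : Prop where
  top : c ν = -1
  neg : ∀ k < 0, c k = 0
  gt : ∀ k > (ν : ℤ), c k = 0

variable {ν : ℕ} {c d : ℤ → ℝ}

lemma IsRecExtension.mem (hc : IsRecExtension ν c) {k : ℤ} (h : c k ≠ 0) : 0 ≤ k ∧ k ≤ ν := by
  constructor
  · by_contra h'
    exact h (hc.neg k (by omega))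
  · by_contra h'
    exact h (hc.gt k (by omega))

lemma sign_sub_sign_eq_zero {e k l : ℤ} (h : ((e + k - l).sign : ℝ) - e.sign ≠ 0) :
    (0 ≤ e → e + k ≤ l) ∧ (e ≤ 0 → l ≤ e + k) ∨ e = 0 := by
  rcases lt_trichotomy e 0 with he | he | he
  · left
    refine ⟨fun _ => by omega, fun _ => ?_⟩
    by_contra hl
    apply h
    rw [Int.sign_eq_neg_one_of_neg he, Int.sign_eq_neg_one_of_neg (by omega)]
    ring
  · exact Or.inr he
  · left
    refine ⟨fun _ => ?_, fun _ => by omega⟩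
    by_contra hl
    apply h
    rw [Int.sign_eq_one_of_pos he, Int.sign_eq_one_of_pos (by omega)]
    ring

/-- Two windows at distance `e`: the products `F_l G_k` of the vertices of the shifted windows
are rewritten in the original ones. -/
lemma sum_sign_reindex (hc : IsRecExtension ν c) (hd : IsRecExtension ν d) (e : ℤ)
    (F G : ℤ → ℝ) :
    ∑ k ∈ Finset.Icc (0 : ℤ) ν, ∑ l ∈ Finset.Icc (0 : ℤ) ν,
      (((e + k - l).sign : ℝ) - e.sign) * (c k * d l) * (F (l - e) * G (k + e))
    = ∑ k ∈ Finset.Icc (0 : ℤ) ν, ∑ l ∈ Finset.Icc (0 : ℤ) ν,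
      (((l - k - e).sign : ℝ) - e.sign) * (c (l - e) * d (k + e)) * (F k * G l) := by
  rw [← Finset.sum_product', ← Finset.sum_product']
  refine Finset.sum_bij_ne_zero (fun p _ _ => (p.2 - e, p.1 + e)) ?_ ?_ ?_ ?_
  · rintro ⟨k, l⟩ hp h0
    simp only [Finset.mem_product, Finset.mem_Icc] at *
    -- A non-zero sign difference confines `l - e` and `k + e` to `[0, ν]`. In the converse
    -- direction the vanishing of the coefficients outside `[0, ν]` does this.
    have h1 := sign_sub_sign_eq_zero (left_ne_zero_of_mul (left_ne_zero_of_mul h0))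
    rcases h1 with h1 | h1
    · rcases le_total 0 e with he | he
      · have := h1.1 he
        omega
      · have := h1.2 he
        omega
    · omega
  · rintro ⟨k, l⟩ _ _ ⟨k', l'⟩ _ _ h
    simp only [Prod.mk.injEq] at *
    omega
  · rintro ⟨k, l⟩ hp h0
    have hm := right_ne_zero_of_mul (left_ne_zero_of_mul h0)
    have h1 := hc.mem (left_ne_zero_of_mul hm)
    have h2 := hd.mem (right_ne_zero_of_mul hm)
    refine ⟨(l - e, k + e), ?_, ?_, ?_⟩
    · simp only [Finset.mem_product, Finset.mem_Icc]
      exact ⟨h1, h2⟩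
    · simp only [add_sub_cancel_right, sub_add_cancel]
      rwa [show e + (l - e) - (k + e) = l - k - e by ring]
    · simp
  · rintro ⟨k, l⟩ _ _
    simp only [add_sub_cancel_right, sub_add_cancel]
    rw [show k + e - (l - e) - e = e + k - l by ring]

/-- Elimination of `F_ν` and `G_ν` by the recurrences. -/
lemma sum_sum_eliminate (A : ℤ → ℤ → ℝ) {F G : ℤ → ℝ}
    (hF : F ν = ∑ k : Fin ν, c (k : ℤ) * F (k : ℤ)) (hG : G ν = ∑ l : Fin ν, d (l : ℤ) * G (l : ℤ)) :
    ∑ k ∈ Finset.Icc (0 : ℤ) ν, ∑ l ∈ Finset.Icc (0 : ℤ) ν, A k l * (F k * G l)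
    = ∑ k : Fin ν, ∑ l : Fin ν, (A k l + A ν l * c k + A k ν * d l + A ν ν * (c k * d l))
      * (F (k : ℤ) * G (l : ℤ)) := by
  simp only [sum_Icc_eq_sum_fin, Finset.sum_add_distrib, add_mul]
  have h1 : ∑ k : Fin ν, A k ν * (F k * G ν) =
      ∑ k : Fin ν, ∑ l : Fin ν, A k ν * d l * (F (k : ℤ) * G (l : ℤ)) := by
    refine Finset.sum_congr rfl fun k _ => ?_
    rw [hG, Finset.mul_sum, Finset.mul_sum]
    exact Finset.sum_congr rfl fun l _ => by ring
  have h2 : ∑ l : Fin ν, A ν l * (F ν * G l) =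
      ∑ k : Fin ν, ∑ l : Fin ν, A ν l * c k * (F (k : ℤ) * G (l : ℤ)) := by
    rw [Finset.sum_comm]
    refine Finset.sum_congr rfl fun l _ => ?_
    rw [hF, Finset.sum_mul, Finset.mul_sum]
    exact Finset.sum_congr rfl fun k _ => by ring
  have h3 : A ν ν * (F ν * G ν) =
      ∑ k : Fin ν, ∑ l : Fin ν, A ν ν * (c k * d l) * (F (k : ℤ) * G (l : ℤ)) := by
    rw [hF, hG, Finset.sum_mul_sum, Finset.mul_sum]
    refine Finset.sum_congr rfl fun k _ => ?_
    rw [Finset.mul_sum]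
    exact Finset.sum_congr rfl fun l _ => by ring
  rw [h1, h2, h3]
  ring

/-- A matrix is determined by the corresponding combination of products of the entries of two
invertible matrices. -/
lemma eq_of_sum_sum_eq {X Y W U : Matrix (Fin ν) (Fin ν) ℝ} (hW : IsUnit W.det)
    (hU : IsUnit U.det)
    (h : ∀ a b, ∑ k, ∑ l, X k l * (W k a * U l b) = ∑ k, ∑ l, Y k l * (W k a * U l b)) :
    X = Y := by
  have key : ∀ Z : Matrix (Fin ν) (Fin ν) ℝ, ∀ a b,
      (W.transpose * Z * U) a b = ∑ k, ∑ l, Z k l * (W k a * U l b) := by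
    intro Z a b
    simp only [Matrix.mul_apply, Matrix.transpose_apply, Finset.sum_mul]
    rw [Finset.sum_comm]
    exact Finset.sum_congr rfl fun k _ => Finset.sum_congr rfl fun l _ => by ring
  have h1 : W.transpose * X * U = W.transpose * Y * U := by
    ext a b
    rw [key, key, h]
  have hW' : IsUnit W.transpose.det := by rwa [Matrix.det_transpose]
  have h2 := congrArg (fun Z => W.transpose⁻¹ * (Z * U⁻¹)) h1
  simpa [mul_assoc, Matrix.mul_nonsing_inv _ hU, Matrix.nonsing_inv_mul_cancel_left _ _ hW']
    using h2

/-- The contributions of the last rows and columns after elimination. -/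
lemma sign_eliminate (hc : IsRecExtension ν c) (hd : IsRecExtension ν d) {e : ℤ}
    (hcd : e = 0 → c = d) {k l : ℤ} (hk : k < ν) (hl : l < ν) :
    (((l - ν - e).sign : ℝ) - e.sign) * (c (l - e) * d (ν + e)) * c k
    + (((ν - k - e).sign : ℝ) - e.sign) * (c (ν - e) * d (k + e)) * d l
    + (((ν - ν - e : ℤ).sign : ℝ) - e.sign) * (c (ν - e) * d (ν + e)) * (c k * d l)
    = ((if k + e = ν then 1 else 0) - (if l - e = ν then 1 else 0)) * (c k * d l) := by
  rcases lt_trichotomy e 0 with he | he | he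
  · rw [hc.gt (ν - e) (by omega), if_neg (show ¬ k + e = ν by omega)]
    split_ifs with h
    · obtain rfl : l = ν + e := by omega
      rw [Int.sign_eq_neg_one_of_neg he, h, hc.top, show (ν : ℤ) + e - ν - e = 0 by ring]
      simp [mul_comm]
    · rw [Int.sign_eq_neg_one_of_neg he]
      rcases lt_or_gt_of_ne h with h | h
      · rw [Int.sign_eq_neg_one_of_neg (show l - ν - e < 0 by omega)]
        simp
      · rw [hc.gt (l - e) h]
        simp
  · obtain rfl := hcd he
    subst he
    rw [if_neg (by omega), if_neg (by omega)]
    simp only [sub_zero, add_zero, hc.top]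
    rw [Int.sign_eq_neg_one_of_neg (show l - ν < 0 by omega),
      Int.sign_eq_one_of_pos (show ν - k > 0 by omega)]
    simp
    ring
  · rw [hd.gt (ν + e) (by omega), if_neg (show ¬ l - e = ν by omega)]
    split_ifs with h
    · obtain rfl : k = ν - e := by omega
      rw [Int.sign_eq_one_of_pos he, h, hd.top, show (ν : ℤ) - (ν - e) - e = 0 by ring]
      simp
    · rw [Int.sign_eq_one_of_pos he]
      rcases lt_or_gt_of_ne h with h | h
      · rw [Int.sign_eq_one_of_pos (show ν - k - e > 0 by omega)]
        simp
      · rw [hd.gt (k + e) h]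
        simp

end Bilinear

/-! ### The bracket of the coefficients -/

section CoefficientBracket

variable {N ν : ℕ} [NeZero N]

/-- The coefficient `c_k` of the recurrence at `m`, with `c_ν = -1` and `c_k = 0` outside
`[0, ν]`. -/
def recExt (u : Coeffs N ν) (m : ZMod N) (k : ℤ) : ℝ :=
  if h : 0 ≤ k ∧ k < ν then recCoeff u m ⟨k.toNat, by omega⟩ else if k = ν then -1 else 0

lemma recExt_natCast (u : Coeffs N ν) (m : ZMod N) (k : Fin ν) :
    recExt u m (k : ℤ) = recCoeff u m k := by
  rw [recExt, dif_pos (by omega)]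
  rfl

lemma isRecExtension_recExt (u : Coeffs N ν) (m : ZMod N) : IsRecExtension ν (recExt u m) where
  top := by rw [recExt, dif_neg (by omega), if_pos rfl]
  neg k hk := by rw [recExt, dif_neg (by omega), if_neg (by omega)]
  gt k hk := by rw [recExt, dif_neg (by omega), if_neg (by omega)]

lemma vertex_add_order {x : Config N ν} (hx : x ∈ nondegenerate N ν) (m : ℤ) (a : Fin ν) :
    vertex x (m + ν) a = ∑ k : Fin ν, recExt (coeffs x) m (k : ℤ) * vertex x (m + (k : ℤ)) a := by
  rw [← recCoeff_vecMul_window hx]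
  simp only [recExt_natCast]
  rfl

lemma sum_recExt_mul_vertex {x : Config N ν} (hx : x ∈ nondegenerate N ν) (m : ℤ) (a : Fin ν) :
    ∑ k ∈ Finset.Icc (0 : ℤ) ν, recExt (coeffs x) m k * vertex x (m + k) a = 0 := by
  rw [sum_Icc_eq_sum_fin, ← vertex_add_order hx, (isRecExtension_recExt _ _).top]
  ring

/-- The displacement of the window at `m` translated by `j` periods from the window at `n`. -/
def displacement (m n : ZMod N) (j : ℤ) : ℤ := m.val - n.val + j * N

/-- The bracket of the coefficients `c_k` at `m` and `c_l` at `n` of the recurrence, before the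
elimination of `V_{m+ν}` and `V_{n+ν}`. -/
def rawBracket (φ : ZMod N → ℝ) (u : Coeffs N ν) (m n : ZMod N) (k l : ℤ) : ℝ :=
  φ (m - n + k - l) * (recExt u m k * recExt u n l)
  + ∑ j ∈ ({-1, 0, 1} : Finset ℤ),
    (((l - k - displacement m n j).sign : ℝ) - (displacement m n j).sign)
      * (recExt u m (l - displacement m n j) * recExt u n (k + displacement m n j))

/-- The bracket of the coefficients `c_k` at `m` and `c_l` at `n` of the recurrence. -/
def recBracket (φ : ZMod N → ℝ) (u : Coeffs N ν) (m n : ZMod N) (k l : Fin ν) : ℝ :=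
  (φ (m - n + (k : ℤ) - (l : ℤ)) - φ (m - n + (ν : ℤ) - (l : ℤ)) - φ (m - n + (k : ℤ) - (ν : ℤ))
    + φ (m - n) + ∑ j ∈ ({-1, 0, 1} : Finset ℤ),
      ((if (k : ℤ) + displacement m n j = ν then 1 else 0)
        - (if (l : ℤ) - displacement m n j = ν then 1 else 0)))
    * (recExt u m (k : ℤ) * recExt u n (l : ℤ))
  + ∑ j ∈ ({-1, 0, 1} : Finset ℤ),
    ((((l : ℤ) - (k : ℤ) - displacement m n j).sign : ℝ) - (displacement m n j).sign)
      * (recExt u m (l - displacement m n j) * recExt u n (k + displacement m n j))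

lemma displacement_eq_zero {m n : ZMod N} {j : ℤ} (h : displacement m n j = 0) : m = n := by
  have := congrArg (Int.cast : ℤ → ZMod N) h
  simpa [displacement, sub_eq_zero] using this

/-- The left side is what elimination of `V_{m+ν}` and `V_{n+ν}` produces; `sign_eliminate` reduces
the boundary sign terms to indicators. A zero displacement means `m = n`, so the two coefficient
sequences coincide as required there. -/
lemma recBracket_eq (φ : ZMod N → ℝ) (u : Coeffs N ν) (m n : ZMod N) (k l : Fin ν) :
    rawBracket φ u m n (k : ℤ) (l : ℤ) + rawBracket φ u m n ν (l : ℤ) * recExt u m (k : ℤ)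
      + rawBracket φ u m n (k : ℤ) ν * recExt u n (l : ℤ)
      + rawBracket φ u m n ν ν * (recExt u m (k : ℤ) * recExt u n (l : ℤ))
    = recBracket φ u m n k l := by
  have hc := isRecExtension_recExt u m
  have hd := isRecExtension_recExt u n
  have h : ∀ j, _ := fun j => sign_eliminate hc hd (e := displacement m n j)
    (fun h => by rw [displacement_eq_zero h]) (k := (k : ℤ)) (l := (l : ℤ)) (by omega) (by omega)
  rw [recBracket, add_mul, Finset.sum_mul, ← Finset.sum_congr rfl fun j _ => h j]
  simp only [rawBracket, Finset.sum_add_distrib, hc.top, hd.top, Finset.sum_mul, add_mul]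
  have e : m - n + ((ν : ℤ) : ZMod N) - ((ν : ℤ) : ZMod N) = m - n := by ring
  rw [e]
  ring

section

variable {R : Tensor2 ν} (φ : ZMod N → ℝ) {x : Config N ν}

lemma sum_recExt_mul_translateTerm (hx : x ∈ nondegenerate N ν) (m n : ZMod N) (a b : Fin ν)
    (j : ℤ) :
    ∑ k ∈ Finset.Icc (0 : ℤ) ν, ∑ l ∈ Finset.Icc (0 : ℤ) ν,
      recExt (coeffs x) m k * recExt (coeffs x) n l
        * translateTerm x (m.val + k) (n.val + l) a b j
    = ∑ k ∈ Finset.Icc (0 : ℤ) ν, ∑ l ∈ Finset.Icc (0 : ℤ) ν,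
      (((l - k - displacement m n j).sign : ℝ) - (displacement m n j).sign)
        * (recExt (coeffs x) m (l - displacement m n j)
          * recExt (coeffs x) n (k + displacement m n j))
        * (vertex x (m.val + k) a * vertex x (n.val + l) b) := by
  rw [← sum_sign_reindex (isRecExtension_recExt _ m) (isRecExtension_recExt _ n)
    (displacement m n j) (fun k => vertex x (m.val + k) a) (fun l => vertex x (n.val + l) b)]
  rw [← sub_eq_zero, ← Finset.sum_sub_distrib]
  simp only [← Finset.sum_sub_distrib]
  -- Replacing `sign j` by the sign of the displacement costs a weight independent of `k` and `l`,
  -- and such a term vanishes by the recurrence translated by `j` periods.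
  rw [← sum_sum_mul_left_eq_zero (s := Finset.Icc (0 : ℤ) ν) (t := Finset.Icc (0 : ℤ) ν)
    (c := recExt (coeffs x) m) (F := fun k l =>
      (((displacement m n j).sign : ℝ) - (j.sign : ℝ))
        * (vertex x (n.val + l - j * N) a * vertex x (m.val + k + j * N) b)) ?_
    (recExt (coeffs x) n)]
  · refine Finset.sum_congr rfl fun k _ => Finset.sum_congr rfl fun l _ => ?_
    have e1 : (m.val : ℤ) + k - (n.val + l) + j * N = displacement m n j + k - l := by
      simp only [displacement]; ring
    have e2 : (m.val : ℤ) + (l - displacement m n j) = n.val + l - j * N := by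
      simp only [displacement]; ring
    have e3 : (n.val : ℤ) + (k + displacement m n j) = m.val + k + j * N := by
      simp only [displacement]; ring
    simp only [translateTerm, e1, e2, e3]
    ring
  · intro l _
    have h := sum_recExt_mul_vertex hx (m.val + j * N) b
    have hm : (((m.val : ℤ) + j * N : ℤ) : ZMod N) = m := by simp
    rw [hm] at h
    have e : ∀ k, (m.val : ℤ) + k + j * N = m.val + j * N + k := fun k => by ring
    simp only [e]
    calc _ = ((((displacement m n j).sign : ℝ) - (j.sign : ℝ)) * vertex x (n.val + l - j * N) a)
        * ∑ k ∈ Finset.Icc (0 : ℤ) ν, recExt (coeffs x) m k * vertex x (m.val + j * N + k) b := by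
          rw [Finset.mul_sum]
          exact Finset.sum_congr rfl fun k _ => by ring
      _ = 0 := by rw [h, mul_zero]

lemma sum_recExt_mul_bracketForm (hR : IsRMatrix R) (hν : ν < N) (hx : x ∈ nondegenerate N ν)
    (m n : ZMod N) (a b : Fin ν) :
    ∑ k ∈ Finset.Icc (0 : ℤ) ν, ∑ l ∈ Finset.Icc (0 : ℤ) ν,
      recExt (coeffs x) m k * recExt (coeffs x) n l
        * bracketForm R φ x (dVertex x (m.val + k) a) (dVertex x (n.val + l) b)
    = ∑ k ∈ Finset.Icc (0 : ℤ) ν, ∑ l ∈ Finset.Icc (0 : ℤ) ν,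
      rawBracket φ (coeffs x) m n k l * (vertex x (m.val + k) a * vertex x (n.val + l) b) := by
  have hm := ZMod.val_lt m
  have hn := ZMod.val_lt n
  have hvm : ∀ a, ∑ k ∈ Finset.Icc (0 : ℤ) ν, recExt (coeffs x) m k * vertex x (m.val + k) a = 0 :=
    fun a => by simpa using sum_recExt_mul_vertex hx m.val a
  have hvn : ∀ a, ∑ k ∈ Finset.Icc (0 : ℤ) ν, recExt (coeffs x) n k * vertex x (n.val + k) a = 0 :=
    fun a => by simpa using sum_recExt_mul_vertex hx n.val a
  have hRz : ∑ k ∈ Finset.Icc (0 : ℤ) ν, ∑ l ∈ Finset.Icc (0 : ℤ) ν,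
      recExt (coeffs x) m k * recExt (coeffs x) n l
        * Matrix.vecMul (tensorVec (vertex x (m.val + k)) (vertex x (n.val + l))) R (a, b) = 0 := by
    refine sum_sum_mul_left_eq_zero (fun l _ => ?_) _
    simp only [Matrix.vecMul, dotProduct, Finset.mul_sum]
    rw [Finset.sum_comm]
    refine Finset.sum_eq_zero fun p _ => ?_
    calc _ = (vertex x (n.val + l) p.2 * R p (a, b))
        * ∑ k ∈ Finset.Icc (0 : ℤ) ν, recExt (coeffs x) m k * vertex x (m.val + k) p.1 := by
          rw [Finset.mul_sum]
          refine Finset.sum_congr rfl fun k _ => ?_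
          simp only [tensorVec]
          ring
      _ = 0 := by rw [hvm, mul_zero]
  -- The period count of `n + l` does not involve `k`, so the recurrence at `m` kills it; the count
  -- of `m + k` is killed by the recurrence at `n`.
  have hq1 : ∑ k ∈ Finset.Icc (0 : ℤ) ν, ∑ l ∈ Finset.Icc (0 : ℤ) ν,
      recExt (coeffs x) m k * recExt (coeffs x) n l
        * (2 / ν * (((n.val + l : ℤ) / N : ℤ) : ℝ)
          * (vertex x (m.val + k) a * vertex x (n.val + l) b)) = 0 := by
    refine sum_sum_mul_left_eq_zero (fun l _ => ?_) _
    calc _ = (2 / ν * (((n.val + l : ℤ) / N : ℤ) : ℝ) * vertex x (n.val + l) b)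
        * ∑ k ∈ Finset.Icc (0 : ℤ) ν, recExt (coeffs x) m k * vertex x (m.val + k) a := by
          rw [Finset.mul_sum]
          exact Finset.sum_congr rfl fun k _ => by ring
      _ = 0 := by rw [hvm, mul_zero]
  have hq2 : ∑ k ∈ Finset.Icc (0 : ℤ) ν, ∑ l ∈ Finset.Icc (0 : ℤ) ν,
      recExt (coeffs x) m k * recExt (coeffs x) n l
        * (2 / ν * (((m.val + k : ℤ) / N : ℤ) : ℝ)
          * (vertex x (m.val + k) a * vertex x (n.val + l) b)) = 0 := by
    refine sum_sum_mul_right_eq_zero (fun k _ => ?_) _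
    calc _ = (2 / ν * (((m.val + k : ℤ) / N : ℤ) : ℝ) * vertex x (m.val + k) a)
        * ∑ l ∈ Finset.Icc (0 : ℤ) ν, recExt (coeffs x) n l * vertex x (n.val + l) b := by
          rw [Finset.mul_sum]
          exact Finset.sum_congr rfl fun k _ => by ring
      _ = 0 := by rw [hvn, mul_zero]
  have hs := fun j => sum_recExt_mul_translateTerm hx m n a b j
  have hexp : ∀ k ∈ Finset.Icc (0 : ℤ) ν, ∀ l ∈ Finset.Icc (0 : ℤ) ν,
      recExt (coeffs x) m k * recExt (coeffs x) n l
        * bracketForm R φ x (dVertex x (m.val + k) a) (dVertex x (n.val + l) b)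
      = recExt (coeffs x) m k * recExt (coeffs x) n l
          * Matrix.vecMul (tensorVec (vertex x (m.val + k)) (vertex x (n.val + l))) R (a, b)
        + φ (m - n + k - l) * (recExt (coeffs x) m k * recExt (coeffs x) n l)
          * (vertex x (m.val + k) a * vertex x (n.val + l) b)
        + recExt (coeffs x) m k * recExt (coeffs x) n l
          * (2 / ν * (((n.val + l : ℤ) / N : ℤ) : ℝ)
            * (vertex x (m.val + k) a * vertex x (n.val + l) b))
        - recExt (coeffs x) m k * recExt (coeffs x) n l
          * (2 / ν * (((m.val + k : ℤ) / N : ℤ) : ℝ)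
            * (vertex x (m.val + k) a * vertex x (n.val + l) b))
        + ∑ j ∈ ({-1, 0, 1} : Finset ℤ), recExt (coeffs x) m k * recExt (coeffs x) n l
          * translateTerm x (m.val + k) (n.val + l) a b j := by
    intro k hk l hl
    rw [Finset.mem_Icc] at hk hl
    rw [bracketForm_dVertex φ hR (by omega) (by omega) (by omega) (by omega), ← Finset.mul_sum]
    have e : (((m.val : ℤ) + k : ℤ) : ZMod N) - (((n.val : ℤ) + l : ℤ) : ZMod N)
        = m - n + k - l := by
      push_cast
      rw [ZMod.natCast_zmod_val, ZMod.natCast_zmod_val]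
      ring
    rw [e]
    ring
  rw [Finset.sum_congr rfl fun k hk => Finset.sum_congr rfl fun l hl => hexp k hk l hl]
  simp only [Finset.sum_add_distrib, Finset.sum_sub_distrib]
  rw [hRz, hq1, hq2]
  have hcomm : ∀ f : ℤ → ℤ → ℤ → ℝ, ∑ k ∈ Finset.Icc (0 : ℤ) ν, ∑ l ∈ Finset.Icc (0 : ℤ) ν,
      ∑ j ∈ ({-1, 0, 1} : Finset ℤ), f k l j = ∑ j ∈ ({-1, 0, 1} : Finset ℤ),
        ∑ k ∈ Finset.Icc (0 : ℤ) ν, ∑ l ∈ Finset.Icc (0 : ℤ) ν, f k l j := by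
    intro f
    rw [Finset.sum_comm]
    rw [Finset.sum_congr rfl fun l _ => Finset.sum_comm, Finset.sum_comm]
    exact Finset.sum_congr rfl fun j _ => Finset.sum_comm
  rw [hcomm, Finset.sum_congr rfl fun j _ => hs j, ← hcomm]
  simp only [rawBracket, add_mul, Finset.sum_add_distrib, Finset.sum_mul]
  ring

lemma bracketForm_dCoeff (hR : IsRMatrix R) (hν : ν < N) (hx : x ∈ nondegenerate N ν)
    (m n : ZMod N) (k l : Fin ν) :
    bracketForm R φ x (dCoeff x m k) (dCoeff x n l) = recBracket φ (coeffs x) m n k l := by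
  have hrel : ∀ (m : ZMod N) (a : Fin ν), ∑ k : Fin ν, vertex x (m.val + (k : ℤ)) a • dCoeff x m k
      = -∑ k ∈ Finset.Icc (0 : ℤ) ν, recExt (coeffs x) m k • dVertex x (m.val + k) a := by
    intro m a
    have h := dVertex_recurrence hν hx m a
    rw [Finset.sum_add_distrib] at h
    have h2 : ∑ k ∈ Finset.Icc (0 : ℤ) ν, recExt (coeffs x) m k • dVertex x (m.val + k) a
        = (∑ k : Fin ν, recCoeff (coeffs x) m k • dVertex x (m.val + (k : ℤ)) a)
          - dVertex x (m.val + ν) a := by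
      refine ContinuousLinearMap.ext fun v => ?_
      simp only [sum_apply, smul_apply, sub_apply, smul_eq_mul]
      rw [sum_Icc_eq_sum_fin]
      simp only [recExt_natCast, (isRecExtension_recExt _ _).top]
      ring
    rw [h2, h]
    abel
  have key : (Matrix.of fun k l => bracketForm R φ x (dCoeff x m k) (dCoeff x n l))
      = Matrix.of fun k l => recBracket φ (coeffs x) m n k l := by
    -- The rows of each window form a basis, so the coefficients of `V_{m+k} ⊗ V_{n+l}` may be
    -- compared.
    refine eq_of_sum_sum_eq (window_isUnit hx m.val) (window_isUnit hx n.val) fun a b => ?_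
    have hvm : vertex x (m.val + ν) a
        = ∑ k : Fin ν, recExt (coeffs x) m (k : ℤ) * vertex x (m.val + (k : ℤ)) a := by
      simpa using vertex_add_order hx m.val a
    have hvn : vertex x (n.val + ν) b
        = ∑ k : Fin ν, recExt (coeffs x) n (k : ℤ) * vertex x (n.val + (k : ℤ)) b := by
      simpa using vertex_add_order hx n.val b
    have h1 := sum_sum_eliminate (rawBracket φ (coeffs x) m n)
      (F := fun k => vertex x (m.val + k) a) (G := fun l => vertex x (n.val + l) b) hvm hvn
    rw [← sum_recExt_mul_bracketForm φ hR hν hx] at h1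
    simp only [recBracket_eq] at h1
    simp only [window, Matrix.of_apply]
    rw [← h1]
    have h2 := congrArg₂ (fun α β => bracketForm R φ x α β) (hrel m a) (hrel n b)
    simp only [map_neg, map_sum, map_smul, LinearMap.neg_apply, LinearMap.sum_apply,
      LinearMap.smul_apply, smul_eq_mul, mul_neg, Finset.sum_neg_distrib, neg_neg, Finset.mul_sum] at h2
    rw [Finset.sum_comm, Finset.sum_comm (s := Finset.Icc (0 : ℤ) ν)]
    convert h2 using 3
    all_goals ring
  exact congrFun (congrFun key k) l

end

end CoefficientBracket

/-! ### The induced bivector -/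

section Induced

variable {N ν : ℕ} [NeZero N]

lemma isOpen_shiftOperators [NeZero ν] : IsOpen (shiftOperators N ν) := by
  have : shiftOperators N ν = ⋂ m : ZMod N, {u : Coeffs N ν | u 0 m ≠ 0} := by
    ext u
    simp [shiftOperators]
  rw [this]
  exact isOpen_iInter_of_finite fun m => isOpen_ne_fun (by fun_prop) continuous_const

/-- The bivector on the space of shift operators induced by the brackets with parameter `φ`. -/
def inducedBivector (φ : ZMod N → ℝ) : Bivector N ν := fun i j u =>
  (-1) ^ (ν - 1 - (i.1 : ℕ)) * (-1) ^ (ν - 1 - (j.1 : ℕ)) * recBracket φ u i.2 j.2 i.1 j.1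

lemma coeffs_eq_recCoeff (x : Config N ν) (k : Fin ν) (m : ZMod N) :
    coeffs x k m = (-1) ^ (ν - 1 - (k : ℕ)) * recCoeff (coeffs x) m k := by
  simp only [recCoeff, ← mul_assoc]
  rw [← mul_pow]
  simp

lemma fderiv_comp_coeffs (hν : ν < N) {x : Config N ν} (hx : x ∈ nondegenerate N ν)
    {F : Coeffs N ν → ℝ} (hF : DifferentiableAt ℝ F (coeffs x)) :
    fderiv ℝ (fun y => F (coeffs y)) x = ∑ i : Fin ν × ZMod N,
      (partialA F (coeffs x) i * (-1) ^ (ν - 1 - (i.1 : ℕ))) • dCoeff x i.2 i.1 := by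
  have hc := differentiableAt_coeffs hν hx
  have h1 : fderiv ℝ (fun y => F (coeffs y)) x
      = (fderiv ℝ F (coeffs x)).comp (fderiv ℝ coeffs x) := fderiv_comp x hF hc
  rw [h1]
  refine ContinuousLinearMap.ext fun v => ?_
  have h2 : ∀ (k : Fin ν) (m : ZMod N), fderiv ℝ coeffs x v k m
      = (-1) ^ (ν - 1 - (k : ℕ)) * dCoeff x m k v := by
    intro k m
    have h3 : HasFDerivAt (fun y : Config N ν => coeffs y k m)
        ((ContinuousLinearMap.proj m : (ZMod N → ℝ) →L[ℝ] ℝ).comp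
          ((ContinuousLinearMap.proj k : (Fin ν → ZMod N → ℝ) →L[ℝ] (ZMod N → ℝ)).comp
            (fderiv ℝ coeffs x))) x :=
      hasFDerivAt_pi'.1 (hasFDerivAt_pi'.1 hc.hasFDerivAt k) m
    have h4 : HasFDerivAt (fun y : Config N ν => coeffs y k m)
        (((-1 : ℝ) ^ (ν - 1 - (k : ℕ))) • dCoeff x m k) x := by
      have : (fun y : Config N ν => coeffs y k m)
          = fun y => (-1) ^ (ν - 1 - (k : ℕ)) * recCoeff (coeffs y) m k := by
        ext y
        exact coeffs_eq_recCoeff y k m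
      rw [this]
      exact (differentiableAt_recCoeff hν hx m k).hasFDerivAt.const_mul _
    exact congrArg (fun T : Config N ν →L[ℝ] ℝ => T v) (h3.unique h4)
  have h5 : fderiv ℝ coeffs x v = ∑ i : Fin ν × ZMod N, ((-1) ^ (ν - 1 - (i.1 : ℕ))
      * dCoeff x i.2 i.1 v) • (Pi.single i.1 (Pi.single i.2 1) : Coeffs N ν) := by
    ext k m
    rw [Finset.sum_apply, Finset.sum_apply, h2, Finset.sum_eq_single (k, m)]
    · simp
    · rintro ⟨k', m'⟩ _ hne
      simp only [Pi.smul_apply, smul_eq_mul, single_single_apply]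
      by_cases hk : k' = k
      · subst hk
        rw [if_pos rfl, if_neg (fun hm => hne (by rw [hm]))]
        simp
      · simp [hk]
    · simp
  rw [ContinuousLinearMap.comp_apply, h5]
  simp only [map_sum, map_smul, sum_apply, smul_apply, smul_eq_mul, partialA]
  exact Finset.sum_congr rfl fun i _ => by ring

lemma isInduced_inducedBivector [NeZero ν] (hν : ν < N) {R : Tensor2 ν} (hR : IsRMatrix R)
    (φ : ZMod N → ℝ) : IsInduced R φ (inducedBivector φ) := by
  intro F H hF hH x hx
  have hmem := isOpen_shiftOperators.mem_nhds (coeffs_mem_shiftOperators hx)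
  have hF' := (hF.contDiffAt hmem).differentiableAt (by simp)
  have hH' := (hH.contDiffAt hmem).differentiableAt (by simp)
  rw [bracketW_eq, fderiv_comp_coeffs hν hx hF', fderiv_comp_coeffs hν hx hH', bracketS]
  simp only [map_sum, map_smul, LinearMap.sum_apply, LinearMap.smul_apply, smul_eq_mul,
    bracketForm_dCoeff φ hR hν hx, inducedBivector, Finset.mul_sum]
  rw [Finset.sum_comm]
  exact Finset.sum_congr rfl fun i _ => Finset.sum_congr rfl fun j _ => by ring

lemma partialA_coordinate (i j : Fin ν × ZMod N) (u : Coeffs N ν) :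
    partialA (fun v : Coeffs N ν => v i.1 i.2) u j = if j = i then 1 else 0 := by
  have h : HasFDerivAt (fun v : Coeffs N ν => v i.1 i.2)
      ((ContinuousLinearMap.proj i.2 : (ZMod N → ℝ) →L[ℝ] ℝ).comp
        (ContinuousLinearMap.proj i.1 : (Fin ν → ZMod N → ℝ) →L[ℝ] (ZMod N → ℝ))) u :=
    ((ContinuousLinearMap.proj i.2 : (ZMod N → ℝ) →L[ℝ] ℝ).comp
      (ContinuousLinearMap.proj i.1 : (Fin ν → ZMod N → ℝ) →L[ℝ] (ZMod N → ℝ))).hasFDerivAt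
  rw [partialA, h.fderiv]
  change (Pi.single j.1 (Pi.single j.2 1) : Coeffs N ν) i.1 i.2 = _
  rw [single_single_apply, ← ite_and]
  simp only [Prod.ext_iff]

lemma bracketS_coordinate (P : Bivector N ν) (i : Fin ν × ZMod N) (F : Coeffs N ν → ℝ)
    (u : Coeffs N ν) :
    bracketS P (fun v => v i.1 i.2) F u = ∑ j, partialA F u j * P i j u := by
  simp [bracketS, partialA_coordinate]

lemma bracketS_coordinate_coordinate (P : Bivector N ν) (i j : Fin ν × ZMod N)
    (u : Coeffs N ν) :
    bracketS P (fun v => v i.1 i.2) (fun v => v j.1 j.2) u = P i j u := by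
  simp [bracketS_coordinate, partialA_coordinate]

/-- Coordinate functions read off the components, and surjectivity of the projection supplies a
polygon over every point. -/
lemma IsInduced.eq_inducedBivector [NeZero ν] (hν : ν < N) {R : Tensor2 ν} (hR : IsRMatrix R)
    {φ : ZMod N → ℝ} {P : Bivector N ν} (hP : IsInduced R φ P) (i j : Fin ν × ZMod N)
    {u : Coeffs N ν} (hu : u ∈ shiftOperators N ν) : P i j u = inducedBivector φ i j u := by
  have hsm : ∀ i : Fin ν × ZMod N,
      ContDiffOn ℝ ∞ (fun v : Coeffs N ν => v i.1 i.2) (shiftOperators N ν) := fun i =>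
    ContDiff.contDiffOn (by fun_prop)
  have h1 := hP _ _ (hsm i) (hsm j) _ (fundamentalPolygon_mem hu)
  have h2 := isInduced_inducedBivector hν hR φ _ _ (hsm i) (hsm j) _ (fundamentalPolygon_mem hu)
  rw [h1, coeffs_fundamentalPolygon hu] at h2
  rwa [bracketS_coordinate_coordinate, bracketS_coordinate_coordinate] at h2

end Induced

/-! ### Special choices of `φ` -/

section Special

variable {N ν : ℕ} [NeZero N]

lemma sum_ite_displacement (m n : ZMod N) {t : ℤ} (h1 : -N < t) (h2 : t < N) :
    ∑ j ∈ ({-1, 0, 1} : Finset ℤ), (if displacement m n j = t then (1 : ℝ) else 0)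
      = if m - n = (t : ZMod N) then 1 else 0 := by
  have hm := ZMod.val_lt m
  have hn := ZMod.val_lt n
  have hiff : m - n = (t : ZMod N) ↔ (N : ℤ) ∣ (m.val : ℤ) - n.val - t := by
    rw [← ZMod.intCast_zmod_eq_zero_iff_dvd, ← sub_eq_zero (a := m - n)]
    push_cast
    rw [ZMod.natCast_zmod_val, ZMod.natCast_zmod_val]
  rw [Finset.sum_insert (by decide), Finset.sum_insert (by decide), Finset.sum_singleton]
  simp only [hiff]
  have hdisp : ∀ j, displacement m n j = m.val - n.val + j * N := fun j => rfl
  have d1 := hdisp (-1)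
  have d2 := hdisp 0
  have d3 := hdisp 1
  by_cases hd : (N : ℤ) ∣ (m.val : ℤ) - n.val - t
  · rw [if_pos hd]
    obtain ⟨q, hq⟩ := hd
    -- Both `m.val - n.val` and `t` lie strictly between `-N` and `N`, so `q` is `-1`, `0` or `1`,
    -- and the matching translate is `j = -q`.
    have hq1 : -2 < q := by
      by_contra hc
      have : (N : ℤ) * q ≤ N * (-2) := mul_le_mul_of_nonneg_left (by omega) (by omega)
      omega
    have hq2 : q < 2 := by
      by_contra hc
      have : (N : ℤ) * 2 ≤ N * q := mul_le_mul_of_nonneg_left (by omega) (by omega)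
      omega
    interval_cases q
    · rw [if_neg (by omega), if_neg (by omega), if_pos (by omega)]; norm_num
    · rw [if_neg (by omega), if_pos (by omega), if_neg (by omega)]; norm_num
    · rw [if_pos (by omega), if_neg (by omega), if_neg (by omega)]; norm_num
  · rw [if_neg hd]
    have hne : ∀ j : ℤ, displacement m n j ≠ t := fun j hj =>
      hd ⟨-j, by linear_combination hj - hdisp j⟩
    simp [hne]

lemma recBracket_zero_left [NeZero ν] (hν : ν < N) (hcop : Nat.Coprime ν N) {φ : ZMod N → ℝ}
    (hφ : IsQuotientKernel ν φ) (u : Coeffs N ν) (m n : ZMod N) (l : Fin ν) :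
    recBracket φ u m n 0 l = 0 := by
  obtain ⟨c, hc⟩ := hφ.first_difference hcop
  have hl := l.2
  -- With `k = 0` the coefficients restrict the displacement `e` to `0 ≤ e ≤ l`, and for `0 < e < l`
  -- the two signs agree. Only the end points contribute.
  have hmain : ∀ j : ℤ, ((((l : ℤ) - ((0 : Fin ν) : ℕ) - displacement m n j).sign : ℝ)
        - (displacement m n j).sign) * (recExt u m (l - displacement m n j)
          * recExt u n (((0 : Fin ν) : ℕ) + displacement m n j))
      = ((if displacement m n j = 0 then 1 else 0) - (if displacement m n j = l then 1 else 0))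
        * (recExt u m 0 * recExt u n l) := by
    intro j
    have hu := isRecExtension_recExt u m
    have hu' := isRecExtension_recExt u n
    have hmn := displacement_eq_zero (m := m) (n := n) (j := j)
    generalize displacement m n j = e at *
    rw [Fin.val_zero, Nat.cast_zero, sub_zero, zero_add]
    rcases lt_trichotomy e 0 with he | he | he
    · rw [hu'.neg e he, if_neg (by omega), if_neg (by omega)]
      ring
    · rw [hmn he]
      subst he
      by_cases h0 : (l : ℤ) = 0
      · rw [h0]
        simp
      · rw [sub_zero, Int.sign_eq_one_of_pos (by omega), if_pos rfl, if_neg (Ne.symm h0)]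
        simp [mul_comm]
    · rw [if_neg (by omega : ¬ e = 0)]
      rcases lt_trichotomy (l : ℤ) e with h | h | h
      · rw [hu.neg _ (by omega), if_neg (by omega)]
        ring
      · rw [if_pos h.symm, h, Int.sign_eq_one_of_pos he]
        simp
      · rw [if_neg (by omega), Int.sign_eq_one_of_pos he,
          Int.sign_eq_one_of_pos (show (l : ℤ) - e > 0 by omega)]
        simp
  have hsum := fun t h1 h2 => sum_ite_displacement (N := N) m n (t := t) h1 h2
  rw [recBracket, Finset.sum_congr rfl fun j _ => hmain j, ← Finset.sum_mul]
  have e1 : ∀ j, (((0 : Fin ν) : ℕ) : ℤ) + displacement m n j = ν ↔ displacement m n j = ν := by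
    intro j
    simp
  have e2 : ∀ j, (l : ℤ) - displacement m n j = ν ↔ displacement m n j = l - ν := by
    intro j
    omega
  simp only [e1, e2, Finset.sum_sub_distrib]
  rw [hsum _ (by omega) (by omega), hsum _ (by omega) (by omega), hsum _ (by omega) (by omega),
    hsum _ (by omega) (by omega)]
  -- The four values of `φ` form a difference of two first differences, so the unknown constant `c`
  -- cancels and the indicators balance.
  have c1 := hc (m - n - (l : ℕ))
  have c2 := hc (m - n - (ν : ℕ))
  have f1 : m - n - (l : ℕ) + (ν : ZMod N) = m - n + ν - (l : ℕ) := by ring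
  have f2 : m - n - (ν : ZMod N) + ν = m - n := by ring
  have g1 : m - n - ((l : ℕ) : ZMod N) = 0 ↔ m - n = (l : ℕ) := sub_eq_zero
  have g2 : m - n - (ν : ZMod N) = 0 ↔ m - n = ν := sub_eq_zero
  have g3 : m - n + ν - ((l : ℕ) : ZMod N) = 0 ↔ m - n = (l : ℕ) - ν := by
    constructor <;> intro h <;> linear_combination h
  rw [f1] at c1
  rw [f2] at c2
  simp only [g1, g2, g3] at c1 c2
  simp only [Fin.val_zero, Nat.cast_zero, Int.cast_zero, Int.cast_natCast, Int.cast_sub, add_zero]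
  rw [← add_mul]
  refine mul_eq_zero_of_left ?_ _
  linarith

lemma recExt_update (u : Coeffs N ν) (r : Fin ν) (h : ZMod N → ℝ) (m : ZMod N) (p : ℤ) :
    recExt (Function.update u r (u r + h)) m p
      = recExt u m p + (if p = r then (-1) ^ (ν - 1 - (r : ℕ)) else 0) * h m := by
  simp only [recExt]
  split_ifs with h1 h2 h2
  · obtain ⟨r, hr⟩ := r
    obtain rfl : r = p.toNat := by simp only at h2; omega
    simp only [recCoeff, Function.update_self, Pi.add_apply]
    ring
  · have : (⟨p.toNat, by omega⟩ : Fin ν) ≠ r := by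
      rintro rfl
      simp only at h2
      omega
    simp only [recCoeff, Function.update_of_ne this]
    ring
  all_goals first | omega | ring

/-- Each product in the bracket has one coefficient at `m` and one at `n`, so the only non-affine
term is a multiple of `h m * h n`; `hκ` and `hs` show that its coefficient is zero. -/
lemma exists_recBracket_update [NeZero ν] (hν : ν < N) (r : Fin ν) {φ : ZMod N → ℝ}
    (hφ : IsQuotientKernel (ν - (r : ℕ)) φ) (hr : 0 < (r : ℕ)) (u : Coeffs N ν) (m n : ZMod N)
    (k l : Fin ν) : ∃ α β : ℝ, ∀ h : ZMod N → ℝ,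
      recBracket φ (Function.update u r (u r + h)) m n k l
        = recBracket φ u m n k l + (α * h m + β * h n) := by
  let δ : ℤ → ℝ := fun p => if p = r then (-1) ^ (ν - 1 - (r : ℕ)) else 0
  let κ : ℝ := φ (m - n + (k : ℤ) - (l : ℤ)) - φ (m - n + (ν : ℤ) - (l : ℤ))
    - φ (m - n + (k : ℤ) - (ν : ℤ)) + φ (m - n) + ∑ j ∈ ({-1, 0, 1} : Finset ℤ),
      ((if (k : ℤ) + displacement m n j = ν then 1 else 0)
        - (if (l : ℤ) - displacement m n j = ν then 1 else 0))
  let s : ℤ → ℝ := fun j =>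
    (((l : ℤ) - (k : ℤ) - displacement m n j).sign : ℝ) - (displacement m n j).sign
  -- Only `k = l = r` matters, and there `κ = 0` is the second difference equation for step `ν - r`.
  have hκ : κ * (δ k * δ l) = 0 := by
    by_cases hk : (k : ℤ) = r
    · by_cases hl : (l : ℤ) = r
      · refine mul_eq_zero_of_left ?_ _
        have e1 : ∀ j, (r : ℤ) + displacement m n j = ν ↔ displacement m n j = ν - r := by
          intro j; omega
        have e2 : ∀ j, (r : ℤ) - displacement m n j = ν ↔ displacement m n j = r - ν := by
          intro j; omega
        simp only [κ, hk, hl, e1, e2, Finset.sum_sub_distrib]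
        rw [sum_ite_displacement m n (by omega) (by omega),
          sum_ite_displacement m n (by omega) (by omega)]
        have h2 := hφ.second_difference (m - n)
        rw [Nat.cast_sub r.2.le] at h2
        have g1 : m - n + ((ν : ZMod N) - (r : ℕ)) = 0 ↔ m - n = (r : ℕ) - ν := by
          constructor <;> intro h <;> linear_combination h
        simp only [g1] at h2
        simp only [Int.cast_sub, Int.cast_natCast]
        have f1 : m - n + ((r : ℕ) : ZMod N) - (r : ℕ) = m - n := by ring
        have f2 : m - n + (ν : ZMod N) - (r : ℕ) = m - n + (ν - (r : ℕ)) := by ring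
        have f3 : m - n + ((r : ℕ) : ZMod N) - ν = m - n - (ν - (r : ℕ)) := by ring
        rw [f1, f2, f3]
        linarith
      · simp [δ, hl]
    · simp [δ, hk]
  -- If both indices equal `r`, then `l - k - e = e` for the displacement `e`, and the sign
  -- difference is zero.
  have hs : ∀ j, s j * (δ (l - displacement m n j) * δ (k + displacement m n j)) = 0 := by
    intro j
    by_cases h1 : (l : ℤ) - displacement m n j = r
    · by_cases h2 : (k : ℤ) + displacement m n j = r
      · have : (l : ℤ) - k - displacement m n j = displacement m n j := by omega
        simp only [s, this, sub_self, zero_mul]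
      · simp [δ, h2]
    · simp [δ, h1]
  refine ⟨κ * (δ k * recExt u n l) + ∑ j ∈ ({-1, 0, 1} : Finset ℤ),
      s j * (δ (l - displacement m n j) * recExt u n (k + displacement m n j)),
    κ * (δ l * recExt u m k) + ∑ j ∈ ({-1, 0, 1} : Finset ℤ),
      s j * (δ (k + displacement m n j) * recExt u m (l - displacement m n j)), fun h => ?_⟩
  have hsum : ∑ j ∈ ({-1, 0, 1} : Finset ℤ),
      s j * ((recExt u m (l - displacement m n j) + δ (l - displacement m n j) * h m)
        * (recExt u n (k + displacement m n j) + δ (k + displacement m n j) * h n))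
      = ∑ j ∈ ({-1, 0, 1} : Finset ℤ),
          s j * (recExt u m (l - displacement m n j) * recExt u n (k + displacement m n j))
        + (∑ j ∈ ({-1, 0, 1} : Finset ℤ),
          s j * (δ (l - displacement m n j) * recExt u n (k + displacement m n j))) * h m
        + (∑ j ∈ ({-1, 0, 1} : Finset ℤ),
          s j * (δ (k + displacement m n j) * recExt u m (l - displacement m n j))) * h n := by
    rw [Finset.sum_mul, Finset.sum_mul, ← Finset.sum_add_distrib, ← Finset.sum_add_distrib]
    refine Finset.sum_congr rfl fun j _ => ?_
    linear_combination (h m * h n) * hs j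
  simp only [recBracket, recExt_update]
  change κ * ((recExt u m k + δ k * h m) * (recExt u n l + δ l * h n)) + ∑ j ∈ _, s j * _ = _
  have hgoal : κ * (recExt u m k * recExt u n l) + ∑ j ∈ ({-1, 0, 1} : Finset ℤ),
      s j * (recExt u m (l - displacement m n j) * recExt u n (k + displacement m n j))
      = recBracket φ u m n k l := rfl
  rw [← recBracket, ← hgoal]
  refine (congrArg₂ (· + ·) rfl hsum).trans ?_
  linear_combination (h m * h n) * hκ

end Special

/-! ### Linearity and Casimirs for an arbitrary induced bivector -/

lemma isLinearIn_of_isInduced {N ν : ℕ} [NeZero N] [NeZero ν] (hν : ν < N) {R : Tensor2 ν}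
    (hR : IsRMatrix R) {k : Fin ν} (hk : 0 < (k : ℕ)) {φ : ZMod N → ℝ}
    (hφ : IsQuotientKernel (ν - (k : ℕ)) φ) {P : Bivector N ν} (hP : IsInduced R φ P) :
    IsLinearIn P k := by
  intro i j u hu
  obtain ⟨α, β, hαβ⟩ := exists_recBracket_update hν k hφ hk u i.2 j.2 i.1 j.1
  let ε : ℝ := (-1) ^ (ν - 1 - (i.1 : ℕ)) * (-1) ^ (ν - 1 - (j.1 : ℕ))
  refine ⟨(ε * α) • LinearMap.proj i.2 + (ε * β) • LinearMap.proj j.2, fun h hh => ?_⟩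
  rw [hP.eq_inducedBivector hν hR _ _ hh, hP.eq_inducedBivector hν hR _ _ hu, inducedBivector,
    hαβ]
  simp only [LinearMap.add_apply, LinearMap.smul_apply, LinearMap.proj_apply, smul_eq_mul,
    inducedBivector, ε]
  ring

lemma bracketS_zero_eq_zero {N ν : ℕ} [NeZero N] [NeZero ν] (hν : ν < N) {R : Tensor2 ν}
    (hR : IsRMatrix R) (hcop : Nat.Coprime ν N) {φ : ZMod N → ℝ} (hφ : IsQuotientKernel ν φ)
    {P : Bivector N ν} (hP : IsInduced R φ P) (m : ZMod N) (F : Coeffs N ν → ℝ)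
    {u : Coeffs N ν} (hu : u ∈ shiftOperators N ν) :
    bracketS P (fun v => v 0 m) F u = 0 := by
  have h := bracketS_coordinate P (0, m) F u
  rw [h]
  refine Finset.sum_eq_zero fun j _ => ?_
  rw [hP.eq_inducedBivector hν hR _ _ hu, inducedBivector, recBracket_zero_left hν hcop hφ,
    mul_zero, mul_zero]

end

end Polygons

theorem theorem1 (N ν : ℕ) [NeZero N] [NeZero ν] (hN : ν < N)
    (R : Tensor2 ν) (hR : IsRMatrix R) :
    -- the non-degenerate polygons project onto the space of shift operators
    (coeffs '' nondegenerate N ν = shiftOperators N ν) ∧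
    -- for every odd periodic `φ` the bracket on polygons induces one on shift operators
    (∀ φ : ZMod N → ℝ, (∀ m, φ (-m) = -φ m) → ∃ P : Bivector N ν, IsInduced R φ P) ∧
    -- the choices of `φ` exist, and are unique if `j` is coprime to `N`
    (∀ j : ℕ, (∃ φ : ZMod N → ℝ, IsQuotientKernel j φ) ∧
      (Nat.Coprime j N → ∃! φ : ZMod N → ℝ, IsQuotientKernel j φ)) ∧
    -- (i)
    (Nat.Coprime ν N → ∀ φ : ZMod N → ℝ, IsQuotientKernel ν φ →
      ∀ P : Bivector N ν, IsInduced R φ P →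
        ∀ m : ZMod N, ∀ F : Coeffs N ν → ℝ, ContDiffOn ℝ ∞ F (shiftOperators N ν) →
          ∀ u ∈ shiftOperators N ν, bracketS P (fun v => v 0 m) F u = 0) ∧
    -- (ii)
    (∀ k : Fin ν, 0 < (k : ℕ) → ∀ φ : ZMod N → ℝ, IsQuotientKernel (ν - (k : ℕ)) φ →
      ∀ P : Bivector N ν, IsInduced R φ P → IsLinearIn P k) := by
  refine ⟨coeffs_image, fun φ _ => ⟨_, isInduced_inducedBivector hN hR φ⟩, fun j =>
    ⟨exists_isQuotientKernel j, fun hj => ?_⟩,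
    fun hcop φ hφ P hP m F _ u hu => bracketS_zero_eq_zero hN hR hcop hφ hP m F hu,
    fun k hk φ hφ P hP => isLinearIn_of_isInduced hN hR hk hφ hP⟩
  obtain ⟨φ, hφ⟩ := exists_isQuotientKernel (N := N) j
  exact ⟨φ, hφ, fun ψ hψ => isQuotientKernel_unique hj hψ hφ⟩
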